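/- **Setting.** Fix a nonempty finite set of physical indices. An MPS tensor is a finite family of complex $D\times D$ matrices $A=(A^i)_i$, $D\ge 1$, with $|\psi_A\rangle=\sum_{i_1,\dots,i_N}\mathrm{Tr}[A^{i_1}\cdots A^{i_N}]\,|i_1\dots i_N\rangle$; an MPO tensor is a family $T=(T^{ij})_{i,j}$ of $\chi\times\chi$ matrices, $\chi\ge1$, with $U=U_N=\sum \mathrm{Tr}[T^{i_1j_1}\cdots T^{i_Nj_N}]\,|i_1\dots i_N\rangle\langle j_1\dots j_N|$. A tensor is injective if, as a linear map from the virtual to the physical space, it has a left inverse. $TT$, $TA$, $TTT$, $TTA$, $Te$ denote the tensors obtained by placing copies of $T$ above $T$, $A$, or $e$ (contracting physical indices and tensoring bond spaces, the uppermost layer first); e.g. $(Te)^i=\sum_j T^{ij}\otimes e^j$. For a word $w=i_1\dots i_m$ write $X^w=X^{i_1}\cdots X^{i_m}$. In $T^w$, $(TT)^w$, $(TTT)^w$ the letters of $w$ are pairs (output, input) of physical indices. For tensors $X,Y$ with the same physical indices, a *reduction* of $X$ to $Y$ is a pair of matrices $(R,\widehat R)$ with $$\widehat R\,X^w R=Y^w\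 \text{ for all words } w \text{ (including the empty one)},\qquad X^iX^wX^j=X^iR\,Y^w\widehat R\,X^j\ \text{ for all letters } i,j \text{ and nonempty words } w .$$ *Fusion tensors* $(V,\widehat V)$ of $T$: a reduction of $TT$ to the bond-dimension-one tensor $\delta_{ij}$ of the identity operator. *Action tensors* $(W_B,\widehat W_B)$: a reduction of $TA$ to $B$; *action tensors* $(W_A,\widehat W_A)$: a reduction of $TB$ to $A$. **Assumptions.** $T$ is injective and, for all $N\ge1$, $U_N$ is unitary with $U_N^2=\mathbb 1$. $A$ and $B$ are injective and $U|\psi_A\rangle=|\psi_B\rangle$ for all $N\ge1$ (hence also $U|\psi_B\rangle=|\psi_A\rangle$). **Claim.** 0. There is $k_0\ge1$ such that for every $k\ge k_0$ the tensors obtained from $T,A,B$ by blocking $k$ sites possess fusion tensors and both kinds of action tensors. 1. There is $\omega\in\{1,-1\}$ such that, for every choice of fusion tensors $(V,\widehat V)$ of $T$, $\omega$ is the unique number satisfying, for all words $w$ of length $3$, $$(\widehat V\otimes\mathbb 1)\,(TTT)^w\,(\mathbb 1\otimes V)=\omega\,T^w .$$ 2. For every choice of fusion tensors and action tensors there are unique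 numbers $L_A,L_B$ with $$(TTA)^w\,(V\otimes\mathbb 1)=L_A\,(TTA)^w\,(\mathbb 1\otimes W_B)\,W_A,\qquad (TTB)^w\,(V\otimes\mathbb 1)=L_B\,(TTB)^w\,(\mathbb 1\otimes W_A)\,W_B$$ for all words $w$ of length $3$. They are nonzero and $$L_A/L_B=\omega .$$ 3. In the situation of 2, let $e_{AB},e_{BA}$ be nonzero domain wall tensors: $e_{AB}^i$ has size $D_A\times D_B$ and $e_{BA}^i$ has size $D_B\times D_A$. If $c_{AB},c_{BA}$ satisfy, for all $i,j,k$, $$\widehat W_B\,(TA)^i(Te_{AB})^j(TB)^k\,W_A=c_{AB}\,B^ie_{BA}^jA^k,\qquad \widehat W_A\,(TB)^i(Te_{BA})^j(TA)^k\,W_B=c_{BA}\,A^ie_{AB}^jB^k,\tag{$*$}$$ then $$c_{BA}\,c_{AB}=L_A/L_B=\omega .$$ In particular this product does not depend on the choice of fusion and action tensors. 4. In the situation of 3, let $|\psi(A\!-\!B\!-\!A)\rangle$ be the periodic state with tensor $e_{AB}$ at site $k$, $e_{BA}$ at site $l>k$, $B$ between them and $A$ elsewhere, and let $|\psi(B\!-\!A\!-\!B)\rangle$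 be the state with the roles of $A$ and $B$ exchanged ($e_{BA}$ at site $k$, $e_{AB}$ at site $l$). If there are at least three sites in each of the two regions between the walls and $$U|\psi(A\!-\!B\!-\!A)\rangle=c\,|\psi(B\!-\!A\!-\!B)\rangle$$ for some number $c$, then there exist $c_{AB},c_{BA}$ satisfying $(*)$, with $c_{BA}c_{AB}=c=L_A/L_B=\omega$. -/

import Mathlib

/-! Tensors of matrix product states and operators. A matrix product state (MPS) tensor with
physical index set `ι` and bond index set `α` is a family `A : ι → Matrix α α ℂ`; a matrix product
operator (MPO) tensor is a family `T : ι → ι → Matrix χ χ ℂ`, where `T i j` belongs to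
`|i⟩⟨j|`. -/

namespace MPU

section Tensors

variable {ι χ α β γ : Type*}

/-- The product `A^{i₁} ⋯ A^{i_m}` along a word `i₁ … i_m` (the identity for the empty word). -/
def word [Fintype α] [DecidableEq α] (A : ι → Matrix α α ℂ) (w : List ι) : Matrix α α ℂ :=
  (w.map A).prod

/-- The periodic MPS `|ψ_A⟩ = ∑ Tr[A^{i₁} ⋯ A^{i_N}] |i₁ … i_N⟩` on `N` sites. -/
def mps [Fintype α] [DecidableEq α] (A : ι → Matrix α α ℂ) (N : ℕ) : (Fin N → ι) → ℂ :=
  fun s => (word A (List.ofFn s)).trace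

/-- The MPO `U = ∑ Tr[T^{i₁ j₁} ⋯ T^{i_N j_N}] |i₁ … i_N⟩⟨j₁ … j_N|` on `N` sites. -/
def mpo [Fintype χ] [DecidableEq χ] (T : ι → ι → Matrix χ χ ℂ) (N : ℕ) :
    Matrix (Fin N → ι) (Fin N → ι) ℂ :=
  Matrix.of fun s t => (List.ofFn fun n => T (s n) (t n)).prod.trace

/-- `T` generates a matrix product unitary: the MPO is unitary on every nonempty chain. -/
def IsMPU [Fintype ι] [DecidableEq ι] [Fintype χ] [DecidableEq χ]
    (T : ι → ι → Matrix χ χ ℂ) : Prop :=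
  ∀ N : ℕ, 0 < N → mpo T N ∈ Matrix.unitaryGroup (Fin N → ι) ℂ

/-- `A`, read as a map from the virtual space `ℂ^α ⊗ ℂ^α` to the physical space `ℂ^ι`, has a left
inverse. -/
def IsInjective [Fintype ι] [DecidableEq α] (A : ι → Matrix α α ℂ) : Prop :=
  ∃ Ainv : ι → Matrix α α ℂ, ∀ a b a' b' : α,
    ∑ i, Ainv i a b * A i a' b' = if a = a' ∧ b = b' then 1 else 0

/-- An MPO tensor viewed as an MPS tensor with physical index set `ι × ι` (vectorization). -/
def vec (T : ι → ι → Matrix χ χ ℂ) : ι × ι → Matrix χ χ ℂ :=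
  fun p => T p.1 p.2

/-- The tensor of the identity operator, with bond dimension one. -/
def idTensor [DecidableEq ι] : ι × ι → Matrix Unit Unit ℂ :=
  fun p => if p.1 = p.2 then 1 else 0

/-- One MPO tensor on top of a (possibly rectangular) MPS tensor. -/
def act [Fintype ι] (T : ι → ι → Matrix χ χ ℂ) (X : ι → Matrix α β ℂ) :
    ι → Matrix (χ × α) (χ × β) ℂ :=
  fun i => ∑ j, Matrix.kroneckerMap (· * ·) (T i j) (X j)

/-- The MPO tensor `T` on top of the MPO tensor `S` (the tensor of the operator product). -/
def stack [Fintype ι] (T : ι → ι → Matrix χ χ ℂ) (S : ι → ι → Matrix α α ℂ) :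
    ι → ι → Matrix (χ × α) (χ × α) ℂ :=
  fun i j => act T (fun k => S k j) i

/-- Blocking `k` sites of an MPS tensor into one. -/
def blockMPS [Fintype α] [DecidableEq α] (k : ℕ) (A : ι → Matrix α α ℂ) :
    (Fin k → ι) → Matrix α α ℂ :=
  fun s => word A (List.ofFn s)

/-- Blocking `k` sites of an MPO tensor into one. -/
def blockMPO [Fintype χ] [DecidableEq χ] (k : ℕ) (T : ι → ι → Matrix χ χ ℂ) :
    (Fin k → ι) → (Fin k → ι) → Matrix χ χ ℂ :=
  fun s t => (List.ofFn fun n => T (s n) (t n)).prod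

/-- A pair of virtual-level tensors which locally reduces the MPS tensor `X` to the MPS tensor `Y`:
enclosing `m ≥ 0` copies of `X` between `left` and `right` gives `m` copies of `Y`, and in a string
of `X`s one may replace any `m + 1 ≥ 1` inner copies of `X` by `right · Y ⋯ Y · left`. -/
structure Reduction [Fintype α] [DecidableEq α] [Fintype β] [DecidableEq β]
    (X : ι → Matrix β β ℂ) (Y : ι → Matrix α α ℂ) where
  left : Matrix α β ℂ
  right : Matrix β α ℂ
  reduce : ∀ w : List ι, left * word X w * right = word Y w
  replace : ∀ (i j : ι) (w : List ι), w ≠ [] →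
    X i * word X w * X j = X i * (right * word Y w * left) * X j

/-- Fusion tensors of an MPO of order two: `right` is `V`, `left` is `V̂`. -/
abbrev FusionTensors [Fintype ι] [DecidableEq ι] [Fintype χ] [DecidableEq χ]
    (T : ι → ι → Matrix χ χ ℂ) :=
  Reduction (vec (stack T T)) (idTensor (ι := ι))

/-- Action tensors for the MPO `T` mapping the MPS of `A` to that of `B`: `right` is `W_B`, `left`
is `Ŵ_B`. -/
abbrev ActionTensors [Fintype ι] [Fintype χ] [DecidableEq χ] [Fintype α] [DecidableEq α]
    [Fintype β] [DecidableEq β] (T : ι → ι → Matrix χ χ ℂ) (A : ι → Matrix α α ℂ)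
    (B : ι → Matrix β β ℂ) :=
  Reduction (act T A) B

/-- `v ⊗ 1` for a column `v` on the two upper lines: the upper two lines are closed by `v`, the
lowest line continues. -/
def closeTop [DecidableEq γ] (v : Matrix (χ × χ) Unit ℂ) : Matrix (χ × (χ × γ)) γ ℂ :=
  Matrix.of fun x c => v (x.1, x.2.1) () * (1 : Matrix γ γ ℂ) x.2.2 c

/-- The mirror image of `closeTop`, for a row `v`. -/
def openTop [DecidableEq γ] (v : Matrix Unit (χ × χ) ℂ) : Matrix γ (χ × (χ × γ)) ℂ :=
  Matrix.of fun c x => v () (x.1, x.2.1) * (1 : Matrix γ γ ℂ) c x.2.2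

/-- `1 ⊗ v`: the two lower lines are closed by the column `v`, the top line continues. -/
def closeBottom [DecidableEq χ] (v : Matrix (χ × χ) Unit ℂ) : Matrix (χ × (χ × χ)) χ ℂ :=
  Matrix.of fun x c => (1 : Matrix χ χ ℂ) x.1 c * v x.2 ()

/-- `1 ⊗ W`: the action tensor `W` on the two lower lines, the top line continues. -/
def actBottom [DecidableEq χ] (W : Matrix (χ × α) β ℂ) :
    Matrix (χ × (χ × α)) (χ × β) ℂ :=
  Matrix.kroneckerMap (· * ·) (1 : Matrix χ χ ℂ) W

/-- `ω` relates the two ways of reducing three stacked copies of `T` to one: fusing the upper two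
layers on the left end and the lower two layers on the right end of a three-site string gives `ω`
times the string of single tensors. -/
def IsAnomalyPhase [Fintype ι] [DecidableEq ι] [Fintype χ] [DecidableEq χ]
    (T : ι → ι → Matrix χ χ ℂ) (F : FusionTensors T) (ω : ℂ) : Prop :=
  ∀ w : List (ι × ι), w.length = 3 →
    (openTop F.left : Matrix χ (χ × (χ × χ)) ℂ) * word (vec (stack T (stack T T))) w *
        closeBottom F.right =
      ω • word (vec T) w

/-- `L` is the `L`-symbol of `A`: on three sites, merging the two layers `T` first equals `L` times
merging them one after the other with `A`. Here `WB` merges `T` with `A` into `B`, and `WA` merges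
`T` with `B` into `A`. -/
def IsLSymbol [Fintype ι] [DecidableEq ι] [Fintype χ] [DecidableEq χ] [Fintype α] [DecidableEq α]
    [Fintype β] [DecidableEq β] (T : ι → ι → Matrix χ χ ℂ) (A : ι → Matrix α α ℂ)
    (B : ι → Matrix β β ℂ) (F : FusionTensors T) (WB : ActionTensors T A B)
    (WA : ActionTensors T B A) (L : ℂ) : Prop :=
  ∀ w : List ι, w.length = 3 →
    word (act T (act T A)) w * (closeTop F.right : Matrix (χ × (χ × α)) α ℂ) =
      L • (word (act T (act T A)) w * (actBottom WB.right * WA.right))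

/-- `c` is the factor with which `T` locally maps the domain wall tensor `eAB` (between `A` on the
left and `B` on the right) to the domain wall tensor `eBA`. -/
def IsWallFactor [Fintype ι] [Fintype χ] [DecidableEq χ] [Fintype α] [DecidableEq α]
    [Fintype β] [DecidableEq β] (T : ι → ι → Matrix χ χ ℂ) (A : ι → Matrix α α ℂ)
    (B : ι → Matrix β β ℂ) (WB : ActionTensors T A B) (WA : ActionTensors T B A)
    (eAB : ι → Matrix α β ℂ) (eBA : ι → Matrix β α ℂ) (c : ℂ) : Prop :=
  ∀ i j k : ι,
    WB.left * (act T A i * act T eAB j * act T B k) * WA.right = c • (B i * eBA j * A k)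

/-- The periodic `N`-site state `|ψ(A-B-A)⟩` with domain walls `eAB` at site `k` and `eBA` at
site `l`. -/
def wallState [Fintype α] [DecidableEq α] [Fintype β] [DecidableEq β]
    (A : ι → Matrix α α ℂ) (B : ι → Matrix β β ℂ) (eAB : ι → Matrix α β ℂ)
    (eBA : ι → Matrix β α ℂ) (N : ℕ) (k l : Fin N) : (Fin N → ι) → ℂ :=
  fun s =>
    (word A ((List.ofFn s).take k) * eAB (s k) * word B (((List.ofFn s).take l).drop (k + 1)) *
      eBA (s l) * word A ((List.ofFn s).drop (l + 1))).trace

end Tensors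

end MPU

/-! Everything rests on rigidity: reductions of one tensor `X` to the same injective tensor `Y`
differ by a single scalar. `Reduction.exists_phase` proves this by inserting an arbitrary word of
`Y`, hence by linearity an arbitrary matrix, between the ends of two different reductions. The
anomaly phase and the `L`-symbols are scalars of this kind. The phase compares fusing the upper two
layers of `TTT` with fusing the lower two. The `L`-symbol compares fusing the two copies of `T` in
`TTA` with absorbing them into the state one after the other. One scalar governs both ends of a
string: if the right tensors differ by `c`, the left ones differ by the inverse of `c`.

The ratio `LA / LB` comes from reducing `TTTA` to `B` with fixed left tensors and different right
tensors (`lsymbol_eq_phase_mul`): one route produces the phase, the other produces both `L`-symbols.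
Applied to the MPO itself, read as a state that `T ⊗ 1` exchanges with the identity operator, the
same relation gives `ω = LA / LB` with `LB = 1` and `LA * ω = 1`, so `ω` is a sign
(`IsPhase.mul_self`).

For domain walls, `TT` is evaluated on `A A A eAB B B B`. Fusing the layers returns the string
unchanged. Trading fusion for sequential absorption costs `LA` at the left end and `LB` at the right
end, and produces both wall factors (`wallFactor_mul_wallFactor`). Conversely, a global exchange of
walls is cut by the replacement property into two local pieces; injectivity turns the trace identity
into an identity of tensor products, which splits into two proportionalities (`exists_wallFactors`).

Existence of the reductions is algebra. If the words of `X` and `Y` have equal traces, the pairs `(X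
i, Y i)` generate a non-unital algebra whose second projection is onto the full matrix algebra and
has nilpotent kernel. Lifting a rank-one idempotent yields the compression (`exists_compression`);
the nilpotent part dies on long words (`exists_reduction_of_trace_eq`), and blocking makes single
letters long enough. -/

namespace MPU

/-! ### Trace-preserving correspondences between matrix algebras: idempotent lifting and compression
-/

section TracePairs

open Polynomial Matrix

variable {m n : Type*} [Fintype m] [DecidableEq m] [Fintype n] [DecidableEq n]

/-- The Fitting idempotent of a square matrix is a polynomial in it without constant term. -/
theorem exists_fitting_idempotent (b : Matrix n n ℂ) :
    ∃ (q : ℂ[X]) (k : ℕ), IsIdempotentElem (aeval b (q * X ^ (k + 1))) ∧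
      b ^ k * aeval b (q * X ^ (k + 1)) = b ^ k := by
  obtain ⟨q, hq, hdvd⟩ := exists_eq_pow_rootMultiplicity_mul_and_not_dvd b.charpoly
    b.charpoly_monic.ne_zero 0
  set k := b.charpoly.rootMultiplicity 0
  rw [C_0, sub_zero] at hq hdvd
  -- The characteristic polynomial is `X ^ k * q` with `X` not dividing `q`. A Bezout identity for
  -- `X ^ (k + 1)` and `q` gives the projection off the generalized kernel. The exponent `k + 1`
  -- rather than `k` excludes a constant term even for invertible `b`.
  have hcop : IsCoprime ((X : ℂ[X]) ^ (k + 1)) q :=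
    ((irreducible_X.coprime_iff_not_dvd).2 hdvd).pow_left
  obtain ⟨v, u, huv⟩ := hcop
  have hz : b ^ k * aeval b q = 0 := by
    have := Matrix.aeval_self_charpoly b
    rwa [hq, map_mul, map_pow, aeval_X] at this
  have h1 : aeval b (v * X ^ (k + 1)) = 1 - aeval b q * aeval b u := by
    rw [eq_sub_iff_add_eq, ← map_mul, ← map_add, mul_comm q u, huv, map_one]
  refine ⟨v, k, ?_, ?_⟩
  · have h2 : aeval b (v * X ^ (k + 1)) = aeval b (v * X) * b ^ k := by
      rw [← aeval_X (R := ℂ) b, ← map_pow, aeval_X, ← map_mul, pow_succ']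
      ring_nf
    unfold IsIdempotentElem
    nth_rw 2 [h1]
    rw [mul_sub, mul_one, h2, mul_assoc, ← mul_assoc (b ^ k), hz]
    simp
  · rw [h1, mul_sub, mul_one, ← mul_assoc, hz, zero_mul, sub_zero]

/-- The factor `X ^ (k + 1)` removes the constant term, so the unit, which `S` may lack, is never
needed. -/
theorem aeval_mul_pow_succ_mem {R : Type*} [Ring R] [Algebra ℂ R] (S : NonUnitalSubalgebra ℂ R)
    {z : R} (hz : z ∈ S) (q : ℂ[X]) (k : ℕ) : aeval z (q * X ^ (k + 1)) ∈ S := by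
  have hpow : ∀ j : ℕ, z ^ (j + 1) ∈ S := by
    intro j
    induction j with
    | zero => simpa using hz
    | succ j ih => rw [pow_succ]; exact S.mul_mem ih hz
  induction q using Polynomial.induction_on' with
  | add p q hp hq => rw [add_mul, map_add]; exact S.add_mem hp hq
  | monomial j a =>
    rw [map_mul, map_pow, aeval_X, aeval_monomial, mul_assoc, ← pow_add, ← add_assoc,
      ← Algebra.smul_def]
    exact S.toSubmodule.smul_mem a (hpow _)

theorem aeval_fst {R R' : Type*} [Ring R] [Algebra ℂ R] [Ring R'] [Algebra ℂ R'] (z : R × R')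
    (q : ℂ[X]) : (aeval z q).1 = aeval z.1 q :=
  (aeval_algHom_apply (AlgHom.fst ℂ R R') z q).symm

theorem aeval_snd {R R' : Type*} [Ring R] [Algebra ℂ R] [Ring R'] [Algebra ℂ R'] (z : R × R')
    (q : ℂ[X]) : (aeval z q).2 = aeval z.2 q :=
  (aeval_algHom_apply (AlgHom.snd ℂ R R') z q).symm

theorem isIdempotentElem_toLin' {p : Matrix n n ℂ} (hp : IsIdempotentElem p) :
    IsIdempotentElem (Matrix.toLin' p) := by
  unfold IsIdempotentElem
  rw [Module.End.mul_eq_comp, ← Matrix.toLin'_mul, hp.eq]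

theorem eq_zero_of_idempotent_of_trace_eq_zero {p : Matrix n n ℂ} (hp : IsIdempotentElem p)
    (htr : p.trace = 0) : p = 0 := by
  have h := (LinearMap.IsIdempotentElem.trace_eq_zero_iff (isIdempotentElem_toLin' hp)).1
    (by rw [Matrix.trace_toLin'_eq]; exact htr)
  simpa using h

/-- The trace of an idempotent is its rank, so the range is a line; its generator is `r`, and `l`
records the coefficients of the columns. -/
theorem exists_vecMulVec_of_idempotent_of_trace_eq_one {p : Matrix n n ℂ}
    (hp : IsIdempotentElem p) (htr : p.trace = 1) :
    ∃ r l : n → ℂ, p = Matrix.vecMulVec r l ∧ l ⬝ᵥ r = 1 := by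
  have h1 : Module.finrank ℂ (LinearMap.range (Matrix.toLin' p)) = 1 := by
    have h := (LinearMap.IsIdempotentElem.isProj_range _ (isIdempotentElem_toLin' hp)).trace
    rw [Matrix.trace_toLin'_eq, htr] at h
    exact_mod_cast h.symm
  obtain ⟨⟨r, hr⟩, -, hspan⟩ := finrank_eq_one_iff'.1 h1
  have hcol : ∀ j, ∃ c : ℂ, c • r = p.col j := by
    intro j
    obtain ⟨c, hc⟩ := hspan ⟨Matrix.toLin' p (Pi.single j 1), ⟨_, rfl⟩⟩
    refine ⟨c, ?_⟩
    have := congrArg Subtype.val hc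
    simpa using this
  choose l hl using hcol
  have hpl : p = Matrix.vecMulVec r l := by
    ext i j
    have := congrFun (hl j) i
    simp only [Pi.smul_apply, smul_eq_mul, Matrix.col_apply] at this
    rw [← this, Matrix.vecMulVec_apply, mul_comm]
  refine ⟨r, l, hpl, ?_⟩
  rw [hpl, Matrix.trace_vecMulVec, dotProduct_comm] at htr
  exact htr

variable (S : NonUnitalSubalgebra ℂ (Matrix n n ℂ × Matrix m m ℂ))

/-- The Fitting idempotent of `b` lies in `S` with second component zero, so its trace vanishes and
it is zero; hence some power of `b` is zero. -/
theorem isNilpotent_of_mem_of_trace_eq (htr : ∀ z ∈ S, z.1.trace = z.2.trace)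
    {b : Matrix n n ℂ} (hb : (b, 0) ∈ S) : IsNilpotent b := by
  obtain ⟨q, k, hidem, hk⟩ := exists_fitting_idempotent b
  have hmem := aeval_mul_pow_succ_mem S hb q k
  have htr0 : (aeval b (q * X ^ (k + 1))).trace = 0 := by
    have h := htr _ hmem
    rw [aeval_fst, aeval_snd] at h
    simpa using h
  refine ⟨k, ?_⟩
  rw [← hk, eq_zero_of_idempotent_of_trace_eq_zero hidem htr0, mul_zero]

/-- The trace form is nondegenerate: multiplying by lifts of matrix units reads off every entry of
`y` as the trace of zero. -/
theorem snd_eq_zero_of_mem (htr : ∀ z ∈ S, z.1.trace = z.2.trace)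
    (hsurj : ∀ y, ∃ x, (x, y) ∈ S) {y : Matrix m m ℂ} (hy : (0, y) ∈ S) : y = 0 := by
  ext i j
  obtain ⟨x, hx⟩ := hsurj (Matrix.single j i 1)
  have h := htr _ (S.mul_mem hy hx)
  simp only [Prod.mk_mul_mk, zero_mul, Matrix.trace_zero, Matrix.trace_mul_single] at h
  simpa using h.symm

/-- Idempotents lift to idempotents along the trace-preserving correspondence `S`. -/
theorem exists_idempotent_lift (htr : ∀ z ∈ S, z.1.trace = z.2.trace)
    (hsurj : ∀ y, ∃ x, (x, y) ∈ S) {E : Matrix m m ℂ} (hE : IsIdempotentElem E) :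
    ∃ p : Matrix n n ℂ, (p, E) ∈ S ∧ IsIdempotentElem p := by
  obtain ⟨a, ha⟩ := hsurj E
  obtain ⟨q, k, hidem, hk⟩ := exists_fitting_idempotent a
  have hmem := aeval_mul_pow_succ_mem S ha q k
  set e := aeval a (q * X ^ (k + 1)) with he
  set y := aeval E (q * X ^ (k + 1)) with hy
  have hmem' : (e, y) ∈ S := by
    have h : aeval (a, E) (q * X ^ (k + 1)) = (e, y) := Prod.ext (aeval_fst _ _) (aeval_snd _ _)
    rwa [← h]
  have hpow : (a ^ (k + 1), E) ∈ S := by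
    have h := aeval_mul_pow_succ_mem S ha 1 k
    rw [one_mul, map_pow, aeval_X, Prod.pow_mk, hE.pow_succ_eq] at h
    exact h
  have hyE : E * y = y := by
    rw [hy, mul_comm q, map_mul, ← mul_assoc, map_pow, aeval_X, ← pow_succ', hE.pow_succ_eq,
      hE.pow_succ_eq]
  -- The Fitting idempotent fixes the power `a ^ (k + 1)`, so this difference has first component
  -- zero.
  have h0 : E - E * y = 0 := by
    refine snd_eq_zero_of_mem S htr hsurj ?_
    have h := S.sub_mem hpow (S.mul_mem hpow hmem')
    rwa [Prod.mk_mul_mk, Prod.mk_sub_mk, pow_succ', mul_assoc, hk, sub_self] at h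
  refine ⟨e, ?_, hidem⟩
  rwa [sub_eq_zero.1 h0, hyE]

/-- An algebra of nilpotent matrices is nilpotent. -/
theorem exists_pow_eq_bot_of_isNilpotent (N : Submodule ℂ (Matrix n n ℂ)) (hmul : N * N ≤ N)
    (hnil : ∀ x ∈ N, IsNilpotent x) : ∃ k : ℕ, N ^ (k + 1) = ⊥ := by
  have hanti : Antitone fun k : ℕ => N ^ (k + 1) := by
    refine antitone_nat_of_succ_le fun k => ?_
    calc N ^ (k + 1 + 1) = N ^ k * (N * N) := by rw [pow_succ, pow_succ, mul_assoc]
      _ ≤ N ^ k * N := mul_le_mul' le_rfl hmul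
      _ = N ^ (k + 1) := (pow_succ _ _).symm
  obtain ⟨k, hk⟩ := IsArtinian.monotone_stabilizes
    (⟨fun k => OrderDual.toDual (N ^ (k + 1)), fun i j h => hanti h⟩ :
      ℕ →o (Submodule ℂ (Matrix n n ℂ))ᵒᵈ)
  refine ⟨k, ?_⟩
  set M := N ^ (k + 1) with hM
  have hMM : M * M = M := by
    have := hk (k + 1 + k) (by omega)
    change N ^ (k + 1) = N ^ (k + 1 + k + 1) at this
    rw [hM, ← pow_add, this]
    congr 1
  have hMN : M ≤ N := by simpa using hanti (Nat.zero_le k)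
  by_contra hne
  -- If the stable power `M` were nonzero, a minimal left `M`-module `L` not killed by `M` would
  -- equal `M * x` for some `x` in `L`. Then `x = a * x` with `a` nilpotent, which forces `x = 0`.
  let P : Set (Submodule ℂ (Matrix n n ℂ)) := {L | L ≤ M ∧ M * L ≤ L ∧ M * L ≠ ⊥}
  have hP : P.Nonempty := ⟨M, le_rfl, hMM.le, by rwa [hMM]⟩
  obtain ⟨L, ⟨hLM, hML, hL0⟩, hmin⟩ := (wellFounded_lt.min_mem P hP |> fun h =>
    (⟨_, h, fun L' hL' => wellFounded_lt.not_lt_min P hL'⟩ :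
      ∃ L ∈ P, ∀ L' ∈ P, ¬ L' < L))
  obtain ⟨x, hxL, hx⟩ : ∃ x ∈ L, M * Submodule.span ℂ {x} ≠ ⊥ := by
    by_contra! hcon
    refine hL0 (le_bot_iff.1 (Submodule.mul_le.2 fun y hy x hx => ?_))
    rw [← hcon x hx]
    exact Submodule.mul_mem_mul hy (Submodule.mem_span_singleton_self x)
  have hL'le : M * Submodule.span ℂ {x} ≤ L :=
    (mul_le_mul' le_rfl ((Submodule.span_singleton_le_iff_mem x L).2 hxL)).trans hML
  have hL'eq : M * Submodule.span ℂ {x} = L := by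
    by_contra hne'
    refine hmin _ ⟨hL'le.trans hLM, ?_, ?_⟩ (lt_of_le_of_ne hL'le hne') <;>
      rw [← mul_assoc, hMM]
    exact hx
  obtain ⟨a, haM, hax⟩ := Submodule.mem_mul_span_singleton.1 (hL'eq ▸ hxL)
  obtain ⟨j, hj⟩ := hnil a (hMN haM)
  have hpow : ∀ i : ℕ, a ^ i * x = x := by
    intro i
    induction i with
    | zero => simp
    | succ i ih => rw [pow_succ, mul_assoc, hax, ih]
  have hx0 : x = 0 := by rw [← hpow j, hj, zero_mul]
  exact hx (by rw [hx0]; simp)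

theorem vecMulVec_mul_trace {n : Type*} [Fintype n] (r l : n → ℂ) (d : Matrix n n ℂ) :
    (Matrix.vecMulVec r l * d).trace = l ⬝ᵥ d *ᵥ r := by
  rw [Matrix.vecMulVec_mul, Matrix.trace_vecMulVec, dotProduct_comm, Matrix.dotProduct_mulVec]

/-- The correspondence `S` is implemented by a compression. -/
theorem exists_compression [Nonempty m] (htr : ∀ z ∈ S, z.1.trace = z.2.trace)
    (hsurj : ∀ y, ∃ x, (x, y) ∈ S) :
    ∃ (L : Matrix m n ℂ) (R : Matrix n m ℂ), L * R = 1 ∧ (R * L, 1) ∈ S ∧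
      ∀ x y, (x, y) ∈ S → L * x * R = y := by
  obtain ⟨o⟩ := ‹Nonempty m›
  have hE : IsIdempotentElem (Matrix.single o o (1 : ℂ)) := by
    unfold IsIdempotentElem
    rw [Matrix.single_mul_single_same, one_mul]
  obtain ⟨p, hp, hidem⟩ := exists_idempotent_lift S htr hsurj hE
  obtain ⟨r, l, rfl, hlr⟩ := exists_vecMulVec_of_idempotent_of_trace_eq_one hidem (by
    rw [htr _ hp]; simp)
  -- The lifts `a i`, `b j` of the matrix units `(i, o)` and `(o, j)` transport the line of the
  -- rank-one idempotent. They give the columns of `R` and the rows of `L`, and `key` evaluates all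
  -- matrix elements through traces.
  choose a ha using fun i => hsurj (Matrix.single i o 1)
  choose b hb using fun j => hsurj (Matrix.single o j 1)
  have key : ∀ (d : Matrix n n ℂ) (y : Matrix m m ℂ), (d, y) ∈ S → l ⬝ᵥ d *ᵥ r = y o o := by
    intro d y hd
    have h := htr _ (S.mul_mem hp hd)
    rw [Prod.mk_mul_mk, vecMulVec_mul_trace] at h
    rw [h, Matrix.trace_mul_comm, Matrix.trace_mul_single]
    simp
  refine ⟨Matrix.of fun j => l ᵥ* b j, (Matrix.of fun i => a i *ᵥ r)ᵀ, ?_, ?_, ?_⟩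
  · ext j i
    have h := key _ _ (S.mul_mem (hb j) (ha i))
    rw [← Matrix.mulVec_mulVec, Matrix.dotProduct_mulVec] at h
    rw [Matrix.mul_apply']
    refine Eq.trans h ?_
    rcases eq_or_ne j i with rfl | hji
    · simp
    · simp [hji]
  · have h := S.toSubmodule.sum_mem fun i (_ : i ∈ Finset.univ) =>
      S.mul_mem (S.mul_mem (ha i) hp) (hb i)
    change _ ∈ S at h
    convert h using 1
    refine Prod.ext ?_ ?_
    · rw [Prod.fst_sum]
      simp only [Prod.mk_mul_mk, Matrix.mul_vecMulVec, Matrix.vecMulVec_mul]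
      ext x y
      simp [Matrix.mul_apply, Matrix.sum_apply, Matrix.vecMulVec_apply]
    · rw [Prod.snd_sum]
      simp only [Prod.mk_mul_mk, Matrix.single_mul_single_same, one_mul]
      exact Matrix.sum_single_one.symm
  · intro x y hz
    ext j i
    have h : l ⬝ᵥ (b j * (x * a i)) *ᵥ r =
        (Matrix.single o j (1 : ℂ) * (y * Matrix.single i o 1) : Matrix m m ℂ) o o :=
      key _ _ (S.mul_mem (hb j) (S.mul_mem hz (ha i)))
    rw [← Matrix.mulVec_mulVec, ← Matrix.mulVec_mulVec, Matrix.dotProduct_mulVec] at h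
    rw [Matrix.mul_assoc, Matrix.mul_apply']
    refine Eq.trans ?_ (h.trans ?_)
    · congr 1
    · simp

/-! ### Killing the nilpotent part by long words -/

variable {S} {L : Matrix m n ℂ} {R : Matrix n m ℂ}

/-- Expanding the product uses only elements of `S`, and on the second component `R * L` acts as the
identity. The compressed letters are therefore in the nilpotent kernel. -/
theorem compl_mul_mul_compl_mem (hRL : (R * L, 1) ∈ S) {x : Matrix n n ℂ} {y : Matrix m m ℂ}
    (hx : (x, y) ∈ S) : ((1 - R * L) * x * (1 - R * L), 0) ∈ S := by
  have h := S.add_mem (S.sub_mem (S.sub_mem hx (S.mul_mem hRL hx)) (S.mul_mem hx hRL))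
    (S.mul_mem (S.mul_mem hRL hx) hRL)
  simp only [Prod.mk_mul_mk, Prod.mk_sub_mk, Prod.mk_add_mk] at h
  change (_, _) ∈ S at h
  convert h using 2 <;> noncomm_ring

variable {ι o : Type*}

theorem word_nil {α : Type*} [Fintype α] [DecidableEq α] (X : ι → Matrix α α ℂ) :
    word X [] = 1 := rfl

theorem word_cons {α : Type*} [Fintype α] [DecidableEq α] (X : ι → Matrix α α ℂ) (i : ι)
    (w : List ι) : word X (i :: w) = X i * word X w := by simp [word]

theorem word_append {α : Type*} [Fintype α] [DecidableEq α] (X : ι → Matrix α α ℂ)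
    (u w : List ι) : word X (u ++ w) = word X u * word X w := by simp [word]

/-- If `S` never carries `G` into the part seen by `L`, each letter acts on `G` as its compression
to the complement of `R * L`, which lies in `N`. A word of length `k` thus acts as an element of `N
^ k`. -/
theorem exists_word_mul_eq (hRL : (R * L, 1) ∈ S)
    {X : ι → Matrix n n ℂ} {Y : ι → Matrix m m ℂ} (hX : ∀ i, (X i, Y i) ∈ S) (G : Matrix n o ℂ)
    (hG : L * G = 0) (hSG : ∀ x y, (x, y) ∈ S → L * x * G = 0) (N : Submodule ℂ (Matrix n n ℂ))
    (hN : ∀ x, (x, 0) ∈ S → x ∈ N) (u : List ι) :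
    L * (word X u * G) = 0 ∧ (∀ x y, (x, y) ∈ S → L * x * (word X u * G) = 0) ∧
      ∃ g ∈ N ^ u.length, word X u * G = g * G := by
  induction u with
  | nil =>
    rw [word_nil, Matrix.one_mul]
    exact ⟨hG, hSG, 1, (Submodule.one_le.1 le_rfl : (1 : Matrix n n ℂ) ∈ _), by simp⟩
  | cons i u ih =>
    obtain ⟨h1, h2, g, hg, h3⟩ := ih
    rw [word_cons, Matrix.mul_assoc]
    refine ⟨?_, ?_, (1 - R * L) * X i * (1 - R * L) * g, ?_, ?_⟩
    · rw [← Matrix.mul_assoc]; exact h2 _ _ (hX i)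
    · intro x y hz
      have := h2 _ _ (S.mul_mem hz (hX i))
      simpa [Matrix.mul_assoc] using this
    · rw [List.length_cons, pow_succ']
      exact Submodule.mul_mem_mul (M := N) (hN _ (compl_mul_mul_compl_mem hRL (hX i))) hg
    · have h4 : (1 - R * L) * (word X u * G) = word X u * G := by
        rw [Matrix.sub_mul, Matrix.one_mul, Matrix.mul_assoc, h1, Matrix.mul_zero, sub_zero]
      have h5 : (1 - R * L) * (X i * (word X u * G)) = X i * (word X u * G) := by
        rw [Matrix.sub_mul, Matrix.one_mul, Matrix.mul_assoc, ← Matrix.mul_assoc L, h2 _ _ (hX i),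
          Matrix.mul_zero, sub_zero]
      rw [Matrix.mul_assoc, Matrix.mul_assoc, Matrix.mul_assoc, ← h3, h4, h5]

theorem exists_mul_word_eq (hRL : (R * L, 1) ∈ S)
    {X : ι → Matrix n n ℂ} {Y : ι → Matrix m m ℂ} (hX : ∀ i, (X i, Y i) ∈ S)
    (N : Submodule ℂ (Matrix n n ℂ)) (hN : ∀ x, (x, 0) ∈ S → x ∈ N) (u : List ι)
    (G : Matrix o n ℂ) (hG : G * R = 0) (hSG : ∀ x y, (x, y) ∈ S → G * x * R = 0) :
    ∃ g ∈ N ^ u.length, G * word X u = G * g := by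
  induction u generalizing G with
  | nil => exact ⟨1, (Submodule.one_le.1 le_rfl : (1 : Matrix n n ℂ) ∈ _), by simp [word_nil]⟩
  | cons i u ih =>
    obtain ⟨g, hg, h⟩ := ih (G * X i) (hSG _ _ (hX i)) fun x y hz => by
      have := hSG _ _ (S.mul_mem (hX i) hz)
      simpa [Matrix.mul_assoc] using this
    refine ⟨(1 - R * L) * X i * (1 - R * L) * g, ?_, ?_⟩
    · rw [List.length_cons, pow_succ']
      exact Submodule.mul_mem_mul (M := N) (hN _ (compl_mul_mul_compl_mem hRL (hX i))) hg
    · have h4 : G * (1 - R * L) = G := by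
        rw [Matrix.mul_sub, Matrix.mul_one, ← Matrix.mul_assoc, hG, Matrix.zero_mul, sub_zero]
      have h5 : G * X i * (1 - R * L) = G * X i := by
        rw [Matrix.mul_sub, Matrix.mul_one, ← Matrix.mul_assoc, hSG _ _ (hX i), Matrix.zero_mul,
          sub_zero]
      rw [word_cons, ← Matrix.mul_assoc, h, ← Matrix.mul_assoc, ← Matrix.mul_assoc,
        ← Matrix.mul_assoc, h4, h5]

/-- Both `L * d * d' * R` and `L * d * (R * L) * d' * R` compute the same product of second
components, so passage through the complement is invisible between `L` and `R`. This puts the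
complement under the two preceding lemmas, first on the left and then on the right. -/
theorem word_mul_compl_mul_word_eq_zero (hLR : L * R = 1) (hRL : (R * L, 1) ∈ S)
    (hred : ∀ x y, (x, y) ∈ S → L * x * R = y) {X : ι → Matrix n n ℂ} {Y : ι → Matrix m m ℂ}
    (hX : ∀ i, (X i, Y i) ∈ S) (N : Submodule ℂ (Matrix n n ℂ)) (hN : ∀ x, (x, 0) ∈ S → x ∈ N)
    (u v : List ι) (hu : N ^ u.length = ⊥) (hv : N ^ v.length = ⊥) :
    word X u * (1 - R * L) * word X v = 0 ∧
      ∀ x y, (x, y) ∈ S → word X u * ((1 - R * L) * x * (1 - R * L)) * word X v = 0 := by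
  have hfR : (1 - R * L) * R = 0 := by
    rw [Matrix.sub_mul, Matrix.one_mul, Matrix.mul_assoc, hLR, Matrix.mul_one, sub_self]
  have hLf : L * (1 - R * L) = 0 := by
    rw [Matrix.mul_sub, Matrix.mul_one, ← Matrix.mul_assoc, hLR, Matrix.one_mul, sub_self]
  have hcd : ∀ d y d' y', (d, y) ∈ S → (d', y') ∈ S → L * (d * (1 - R * L) * d') * R = 0 := by
    intro d y d' y' hd hd'
    have h1 := hred _ _ (S.mul_mem hd hd')
    have h2 := hred _ _ (S.mul_mem (S.mul_mem hd hRL) hd')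
    simp only [Prod.mk_mul_mk, mul_one] at h1 h2
    calc L * (d * (1 - R * L) * d') * R
        = L * (d * d') * R - L * (d * (R * L) * d') * R := by
          simp only [Matrix.mul_sub, Matrix.sub_mul, Matrix.mul_one]
      _ = 0 := by rw [h1, h2, sub_self]
  have hleft : ∀ d y, (d, y) ∈ S → word X u * ((1 - R * L) * d * R) = 0 := by
    intro d y hd
    obtain ⟨-, -, g, hg, h⟩ := exists_word_mul_eq hRL hX ((1 - R * L) * d * R)
      (by rw [← Matrix.mul_assoc, ← Matrix.mul_assoc, hLf, Matrix.zero_mul, Matrix.zero_mul])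
      (fun d' y' hd' => by
        have := hcd _ _ _ _ hd' hd
        simpa only [Matrix.mul_assoc] using this) N hN u
    rw [hu, Submodule.mem_bot] at hg
    rw [h, hg, Matrix.zero_mul]
  refine ⟨?_, ?_⟩
  · obtain ⟨g, hg, h⟩ := exists_mul_word_eq hRL hX N hN v (word X u * (1 - R * L))
      (by rw [Matrix.mul_assoc, hfR, Matrix.mul_zero]) (fun d y hd => by
        have := hleft d y hd
        simpa only [Matrix.mul_assoc] using this)
    rw [hv, Submodule.mem_bot] at hg
    rw [h, hg, Matrix.mul_zero]
  · intro x y hx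
    obtain ⟨g, hg, h⟩ := exists_mul_word_eq hRL hX N hN v
      (word X u * ((1 - R * L) * x * (1 - R * L)))
      (by rw [Matrix.mul_assoc, Matrix.mul_assoc, hfR, Matrix.mul_zero, Matrix.mul_zero])
      (fun d y' hd => by
        have h1 := hleft _ _ (S.mul_mem hx hd)
        have h2 := hleft _ _ (S.mul_mem (S.mul_mem hx hRL) hd)
        simp only [Prod.mk_mul_mk] at h1 h2
        calc word X u * ((1 - R * L) * x * (1 - R * L)) * d * R
            = word X u * ((1 - R * L) * (x * d) * R)
              - word X u * ((1 - R * L) * (x * (R * L) * d) * R) := by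
              simp only [Matrix.mul_assoc, Matrix.mul_sub, Matrix.sub_mul, Matrix.mul_one,
                Matrix.one_mul]
          _ = 0 := by rw [h1, h2, sub_self])
    rw [hv, Submodule.mem_bot] at hg
    rw [h, hg, Matrix.mul_zero]

theorem IsInjective.sum_smul_eq_single {m : Type*} [DecidableEq m] [Fintype ι]
    {Y Yinv : ι → Matrix m m ℂ}
    (h : ∀ a b a' b' : m, ∑ i, Yinv i a b * Y i a' b' = if a = a' ∧ b = b' then 1 else 0)
    (a b : m) : ∑ i, Yinv i a b • Y i = Matrix.single a b 1 := by
  ext a' b'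
  simp [Matrix.sum_apply, h, Matrix.single_apply]

theorem IsInjective.span_range [Fintype ι] {Y : ι → Matrix m m ℂ} (hY : IsInjective Y) :
    Submodule.span ℂ (Set.range Y) = ⊤ := by
  obtain ⟨Yinv, h⟩ := hY
  refine eq_top_iff.2 fun M _ => ?_
  rw [Matrix.matrix_eq_sum_single M]
  refine Submodule.sum_mem _ fun a _ => Submodule.sum_mem _ fun b _ => ?_
  have h1 : Matrix.single a b (M a b) = M a b • Matrix.single a b 1 := by
    rw [Matrix.smul_single, smul_eq_mul, mul_one]
  rw [h1, ← IsInjective.sum_smul_eq_single h]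
  exact Submodule.smul_mem _ _ (Submodule.sum_mem _ fun i _ =>
    Submodule.smul_mem _ _ (Submodule.subset_span ⟨i, rfl⟩))

/-- An MPS tensor generating the same states as an injective tensor reduces to it on long
strings. -/
theorem exists_reduction_of_trace_eq [Fintype ι] [Nonempty m] {X : ι → Matrix n n ℂ}
    {Y : ι → Matrix m m ℂ} (hY : IsInjective Y)
    (htr : ∀ w : List ι, w ≠ [] → (word X w).trace = (word Y w).trace) :
    ∃ (L : Matrix m n ℂ) (R : Matrix n m ℂ) (K : ℕ), (∀ w, L * word X w * R = word Y w) ∧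
      ∀ u w v : List ι, K ≤ u.length → w ≠ [] → K ≤ v.length →
        word X u * word X w * word X v = word X u * (R * word Y w * L) * word X v := by
  set S := NonUnitalAlgebra.adjoin ℂ (Set.range fun i => (X i, Y i)) with hS
  have hX : ∀ i, (X i, Y i) ∈ S := fun i => NonUnitalAlgebra.subset_adjoin ℂ ⟨i, rfl⟩
  have hword : ∀ w : List ι, w ≠ [] → (word X w, word Y w) ∈ S := by
    intro w
    induction w with
    | nil => simp
    | cons i w ih =>
      intro _
      rcases eq_or_ne w [] with rfl | hw
      · simpa [word] using hX i
      · rw [word_cons, word_cons]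
        exact S.mul_mem (hX i) (ih hw)
  have htrS : ∀ z ∈ S, z.1.trace = z.2.trace := by
    have hle : S.toSubmodule ≤ LinearMap.eqLocus
        (Matrix.traceLinearMap n ℂ ℂ ∘ₗ LinearMap.fst ℂ _ _)
        (Matrix.traceLinearMap m ℂ ℂ ∘ₗ LinearMap.snd ℂ _ _) := by
      rw [hS, NonUnitalAlgebra.adjoin_eq_span, Submodule.span_le]
      intro z hz
      have hz' : ∃ w : List ι, w ≠ [] ∧ z = (word X w, word Y w) := by
        induction hz using Subsemigroup.closure_induction with
        | mem z hz =>
          obtain ⟨i, rfl⟩ := hz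
          exact ⟨[i], by simp, by simp [word]⟩
        | mul z z' _ _ h h' =>
          obtain ⟨w, hw, rfl⟩ := h
          obtain ⟨w', hw', rfl⟩ := h'
          exact ⟨w ++ w', by simp [hw], by rw [word_append, word_append, Prod.mk_mul_mk]⟩
      obtain ⟨w, hw, rfl⟩ := hz'
      exact htr w hw
    exact fun z hz => hle hz
  have hsurj : ∀ y, ∃ x, (x, y) ∈ S := by
    have hle : Submodule.span ℂ (Set.range Y) ≤ S.toSubmodule.map (LinearMap.snd ℂ _ _) := by
      rw [Submodule.span_le]
      rintro _ ⟨i, rfl⟩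
      exact ⟨_, hX i, rfl⟩
    intro y
    obtain ⟨⟨x, y'⟩, hz, rfl⟩ := hle (hY.span_range ▸ Submodule.mem_top : y ∈ _)
    exact ⟨x, hz⟩
  obtain ⟨L, R, hLR, hRL, hred⟩ := exists_compression S htrS hsurj
  let N : Submodule ℂ (Matrix n n ℂ) := S.toSubmodule.comap (LinearMap.inl ℂ _ _)
  have hN : ∀ x, (x, 0) ∈ S → x ∈ N := fun x hx => hx
  obtain ⟨K, hK⟩ := exists_pow_eq_bot_of_isNilpotent N
    (Submodule.mul_le.2 fun x hx y hy => by
      have h := S.mul_mem (show (x, 0) ∈ S from hx) (show (y, 0) ∈ S from hy)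
      rw [Prod.mk_mul_mk, mul_zero] at h
      exact h)
    fun x hx => isNilpotent_of_mem_of_trace_eq S htrS hx
  have hpow : ∀ j, K + 1 ≤ j → N ^ j = ⊥ := by
    intro j hj
    obtain ⟨i, rfl⟩ := Nat.exists_eq_add_of_le hj
    rw [pow_add, hK, Submodule.bot_mul]
  refine ⟨L, R, K + 1, ?_, ?_⟩
  · intro w
    rcases eq_or_ne w [] with rfl | hw
    · rw [word_nil, word_nil, Matrix.mul_one, hLR]
    · exact hred _ _ (hword w hw)
  · intro u w v hu hw hv
    have key := word_mul_compl_mul_word_eq_zero hLR hRL hred hX N hN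
    have h1 := (key u (w ++ v) (hpow _ hu) (hpow _ (by simp; omega))).1
    have h2 := (key (u ++ w) v (hpow _ (by simp; omega)) (hpow _ hv)).1
    have h3 := (key u v (hpow _ hu) (hpow _ hv)).2 _ _ (hword w hw)
    rw [word_append] at h1 h2
    rw [← hred _ _ (hword w hw), ← sub_eq_zero]
    -- With `f = 1 - R * L`, this is `w - (1 - f) * w * (1 - f) = f * w + w * f - f * w * f`; each
    -- term vanishes between long words.
    have h4 : word X u * word X w * word X v -
        word X u * (R * (L * word X w * R) * L) * word X v =
        word X u * (1 - R * L) * (word X w * word X v) +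
        word X u * word X w * (1 - R * L) * word X v -
        word X u * ((1 - R * L) * word X w * (1 - R * L)) * word X v := by
      simp only [Matrix.mul_assoc, Matrix.mul_sub, Matrix.sub_mul, Matrix.mul_one, Matrix.one_mul]
      abel
    rw [h4, h1, h2, h3]
    simp

end TracePairs

/-! ### Reductions of layered tensors -/

section Layers

set_option linter.unusedSectionVars false

open scoped Kronecker

variable {ι χ χ' α β γ δ : Type*}

theorem sum_ofFn_succ {M : Type*} [AddCommMonoid M] [Fintype ι] (n : ℕ) (f : List ι → M) :
    ∑ v : Fin (n + 1) → ι, f (List.ofFn v) = ∑ i, ∑ v : Fin n → ι, f (i :: List.ofFn v) := by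
  rw [← (Fin.consEquiv fun _ : Fin (n + 1) => ι).sum_comp, Fintype.sum_prod_type]
  simp [Fin.consEquiv]

variable [Fintype ι]

theorem word_act [Fintype χ] [DecidableEq χ] [Fintype α] [DecidableEq α]
    (S : ι → ι → Matrix χ χ ℂ) (X : ι → Matrix α α ℂ) (w : List ι) (n : ℕ) (hw : w.length = n) :
    word (act S X) w = ∑ v : Fin n → ι, word (vec S) (w.zip (List.ofFn v)) ⊗ₖ word X (List.ofFn v) := by
  induction w generalizing n with
  | nil => subst hw; simp [word]
  | cons i w ih =>
    obtain rfl : n = w.length + 1 := hw.symm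
    rw [word_cons, ih _ rfl,
      sum_ofFn_succ w.length fun v => word (vec S) ((i :: w).zip v) ⊗ₖ word X v]
    simp only [List.zip_cons_cons, word_cons, Matrix.mul_kronecker_mul, act, Finset.sum_mul_sum,
      vec]

/-- A product of layered tensors with one rectangular tensor in the middle. -/
theorem word_act_mul_act_mul_word_act [Fintype χ] [DecidableEq χ] [Fintype α] [DecidableEq α]
    [Fintype β] [DecidableEq β] (S : ι → ι → Matrix χ χ ℂ) (X : ι → Matrix α α ℂ)
    (e : ι → Matrix α β ℂ) (Y : ι → Matrix β β ℂ) (x y : List ι) (j : ι) (p q : ℕ)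
    (hx : x.length = p) (hy : y.length = q) :
    word (act S X) x * act S e j * word (act S Y) y =
      ∑ x' : Fin p → ι, ∑ j', ∑ y' : Fin q → ι,
        word (vec S) (x.zip (List.ofFn x') ++ (j, j') :: y.zip (List.ofFn y')) ⊗ₖ
          (word X (List.ofFn x') * e j' * word Y (List.ofFn y')) := by
  rw [word_act S X x _ hx, word_act S Y y _ hy, act]
  rw [Matrix.mul_assoc, Matrix.sum_mul]
  refine Finset.sum_congr rfl fun x' _ => ?_
  rw [Matrix.sum_mul, Matrix.mul_sum]
  refine Finset.sum_congr rfl fun j' _ => ?_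
  rw [Matrix.mul_sum, Matrix.mul_sum]
  refine Finset.sum_congr rfl fun y' _ => ?_
  rw [← Matrix.mul_kronecker_mul, ← Matrix.mul_kronecker_mul, word_append, word_cons, vec,
    Matrix.mul_assoc]

theorem zip_ofFn_ne_nil {w : List ι} (hw : w ≠ []) (v : Fin w.length → ι) :
    w.zip (List.ofFn v) ≠ [] := by
  intro h
  have := congrArg List.length h
  simp at this
  exact hw this

section Lift

variable [Fintype χ] [DecidableEq χ] [Fintype χ'] [DecidableEq χ'] [Fintype α] [DecidableEq α]
  [Fintype β] [DecidableEq β] [Fintype γ] [DecidableEq γ] [Fintype δ] [DecidableEq δ]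

/-- A reduction of MPO tensors induces one after placing both on top of an MPS tensor. -/
def Reduction.actTop {S : ι → ι → Matrix χ χ ℂ} {S' : ι → ι → Matrix χ' χ' ℂ}
    (r : Reduction (vec S) (vec S')) (X : ι → Matrix α α ℂ) : Reduction (act S X) (act S' X) where
  left := r.left ⊗ₖ 1
  right := r.right ⊗ₖ 1
  reduce w := by
    rw [word_act S X w _ rfl, word_act S' X w _ rfl]
    simp only [Matrix.sum_mul, Matrix.mul_sum, ← Matrix.mul_kronecker_mul, r.reduce,
      Matrix.one_mul, Matrix.mul_one]
  replace i j w hw := by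
    rw [word_act S X w _ rfl, word_act S' X w _ rfl, act, act]
    simp only [Matrix.sum_mul, Matrix.mul_sum, ← Matrix.mul_kronecker_mul,
      Matrix.one_mul, Matrix.mul_one]
    refine Finset.sum_congr rfl fun _ _ => Finset.sum_congr rfl fun _ _ =>
      Finset.sum_congr rfl fun _ _ => ?_
    congr 1
    exact r.replace (_, _) (_, _) _ (zip_ofFn_ne_nil hw _)

theorem Reduction.actTop_reduce {S : ι → ι → Matrix χ χ ℂ} {S' : ι → ι → Matrix χ' χ' ℂ}
    (r : Reduction (vec S) (vec S')) (X : ι → Matrix α α ℂ) (e : ι → Matrix α β ℂ)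
    (Y : ι → Matrix β β ℂ) (x y : List ι) (j : ι) :
    (r.left ⊗ₖ (1 : Matrix α α ℂ)) * (word (act S X) x * act S e j * word (act S Y) y) *
      (r.right ⊗ₖ (1 : Matrix β β ℂ)) =
        word (act S' X) x * act S' e j * word (act S' Y) y := by
  rw [word_act_mul_act_mul_word_act (hx := rfl) (hy := rfl),
    word_act_mul_act_mul_word_act (hx := rfl) (hy := rfl)]
  simp only [Matrix.sum_mul, Matrix.mul_sum, ← Matrix.mul_kronecker_mul, r.reduce,
    Matrix.one_mul, Matrix.mul_one]

/-- A reduction of MPS tensors induces one after placing an MPO tensor on top of both. -/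
def Reduction.actBottom {X : ι → Matrix α α ℂ} {Y : ι → Matrix β β ℂ} (r : Reduction X Y)
    (S : ι → ι → Matrix χ χ ℂ) : Reduction (act S X) (act S Y) where
  left := (1 : Matrix χ χ ℂ) ⊗ₖ r.left
  right := (1 : Matrix χ χ ℂ) ⊗ₖ r.right
  reduce w := by
    rw [word_act S X w _ rfl, word_act S Y w _ rfl]
    simp only [Matrix.sum_mul, Matrix.mul_sum, ← Matrix.mul_kronecker_mul, r.reduce,
      Matrix.one_mul, Matrix.mul_one]
  replace i j w hw := by
    rw [word_act S X w _ rfl, word_act S Y w _ rfl, act, act]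
    simp only [Matrix.sum_mul, Matrix.mul_sum, ← Matrix.mul_kronecker_mul,
      Matrix.one_mul, Matrix.mul_one]
    refine Finset.sum_congr rfl fun _ _ => Finset.sum_congr rfl fun _ _ =>
      Finset.sum_congr rfl fun _ _ => ?_
    congr 1
    refine r.replace _ _ _ fun h => hw ?_
    simpa using congrArg List.length h

theorem act_bottom_congr {X : ι → Matrix α α ℂ} {P Q : Matrix α β ℂ} {n : ℕ}
    (h : ∀ w : List ι, w.length = n → word X w * P = word X w * Q) (S : ι → ι → Matrix χ χ ℂ)
    (w : List ι) (hw : w.length = n) :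
    word (act S X) w * ((1 : Matrix χ χ ℂ) ⊗ₖ P) = word (act S X) w * ((1 : Matrix χ χ ℂ) ⊗ₖ Q) := by
  rw [word_act S X w n hw]
  simp only [Matrix.sum_mul, ← Matrix.mul_kronecker_mul, h _ List.length_ofFn]

theorem act_bottom_compress {X : ι → Matrix α α ℂ} {e : ι → Matrix α β ℂ} {Y : ι → Matrix β β ℂ}
    {X' : ι → Matrix γ γ ℂ} {e' : ι → Matrix γ δ ℂ} {Y' : ι → Matrix δ δ ℂ}
    {L : Matrix γ α ℂ} {R : Matrix β δ ℂ} {c : ℂ} {x y : List ι}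
    (h : ∀ (x' y' : List ι) (j : ι), x'.length = x.length → y'.length = y.length →
      L * (word X x' * e j * word Y y') * R = c • (word X' x' * e' j * word Y' y'))
    (S : ι → ι → Matrix χ χ ℂ) (j : ι) :
    ((1 : Matrix χ χ ℂ) ⊗ₖ L) * (word (act S X) x * act S e j * word (act S Y) y) *
      ((1 : Matrix χ χ ℂ) ⊗ₖ R) =
        c • (word (act S X') x * act S e' j * word (act S Y') y) := by
  rw [word_act_mul_act_mul_word_act (hx := rfl) (hy := rfl),
    word_act_mul_act_mul_word_act (hx := rfl) (hy := rfl)]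
  simp only [Matrix.sum_mul, Matrix.mul_sum, ← Matrix.mul_kronecker_mul,
    Matrix.one_mul, Matrix.mul_one, h _ _ _ List.length_ofFn List.length_ofFn,
    Matrix.kronecker_smul, Finset.smul_sum]

theorem word_submatrix (X : ι → Matrix α α ℂ) (e : β ≃ α) (w : List ι) :
    word (fun i => (X i).submatrix e e) w = (word X w).submatrix e e := by
  induction w with
  | nil => simp [word]
  | cons i w ih => rw [word_cons, word_cons, ih, Matrix.submatrix_mul_equiv]

/-- Renaming of bond indices in a reduction. -/
def Reduction.reindex {X : ι → Matrix α α ℂ} {Y : ι → Matrix β β ℂ} (r : Reduction X Y)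
    (e : γ ≃ α) (f : δ ≃ β) :
    Reduction (fun i => (X i).submatrix e e) (fun i => (Y i).submatrix f f) where
  left := r.left.submatrix f e
  right := r.right.submatrix e f
  reduce w := by
    rw [word_submatrix, word_submatrix, Matrix.submatrix_mul_equiv, Matrix.submatrix_mul_equiv,
      r.reduce]
  replace i j w hw := by
    simp only [word_submatrix, Matrix.submatrix_mul_equiv, r.replace i j w hw]

/-- A reduction with its data replaced by equal ones. -/
def Reduction.copy {X X' : ι → Matrix α α ℂ} {Y Y' : ι → Matrix β β ℂ} (r : Reduction X Y)
    (hX : X' = X) (hY : Y' = Y) (L : Matrix β α ℂ) (R : Matrix α β ℂ) (hL : L = r.left)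
    (hR : R = r.right) : Reduction X' Y' where
  left := L
  right := R
  reduce w := by rw [hX, hY, hL, hR, r.reduce]
  replace i j w hw := by rw [hX, hY, hL, hR, r.replace i j w hw]

/-- The identity operator as an MPO tensor. -/
def idMPO (ι : Type*) [DecidableEq ι] : ι → ι → Matrix Unit Unit ℂ := fun i j => idTensor (i, j)

theorem act_idMPO [DecidableEq ι] (e : ι → Matrix α β ℂ) (i : ι) :
    act (idMPO ι) e i = (e i).submatrix (Equiv.punitProd α) (Equiv.punitProd β) := by
  ext ⟨_, a⟩ ⟨_, b⟩
  have h : ∀ k, (if i = k then (1 : Matrix Unit Unit ℂ) else 0) () () = if i = k then 1 else 0 :=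
    fun k => by split_ifs <;> rfl
  simp [act, idMPO, idTensor, Matrix.sum_apply, h]

theorem act_act (T : ι → ι → Matrix χ χ ℂ) (S : ι → ι → Matrix χ' χ' ℂ) (e : ι → Matrix α β ℂ)
    (i : ι) : act T (act S e) i = (act (stack T S) e i).submatrix
      (Equiv.prodAssoc χ χ' α).symm (Equiv.prodAssoc χ χ' β).symm := by
  ext ⟨a, b, c⟩ ⟨a', b', c'⟩
  simp only [act, stack, Matrix.sum_apply, Matrix.kroneckerMap_apply, Matrix.submatrix_apply,
    Equiv.prodAssoc_symm_apply, Finset.mul_sum, Finset.sum_mul, mul_assoc]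
  exact Finset.sum_comm

theorem closeTop_eq (v : Matrix (χ × χ) Unit ℂ) : (closeTop v : Matrix (χ × (χ × α)) α ℂ) =
    (v ⊗ₖ (1 : Matrix α α ℂ)).submatrix (Equiv.prodAssoc χ χ α).symm (Equiv.punitProd α).symm := by
  ext ⟨a, b, c⟩ d
  simp [closeTop]

theorem openTop_eq (v : Matrix Unit (χ × χ) ℂ) : (openTop v : Matrix α (χ × (χ × α)) ℂ) =
    (v ⊗ₖ (1 : Matrix α α ℂ)).submatrix (Equiv.punitProd α).symm (Equiv.prodAssoc χ χ α).symm := by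
  ext d ⟨a, b, c⟩
  simp [openTop]

variable [DecidableEq ι]

theorem act_idMPO_submatrix (X : ι → Matrix α α ℂ) :
    (fun i => (act (idMPO ι) X i).submatrix (Equiv.punitProd α).symm (Equiv.punitProd α).symm) =
      X := by
  funext i
  rw [act_idMPO, Matrix.submatrix_submatrix]
  simp

/-- Fusion of the two upper layers above an MPS tensor. -/
def fuseTop {T : ι → ι → Matrix χ χ ℂ} (F : FusionTensors T) (X : ι → Matrix α α ℂ) :
    Reduction (act T (act T X)) X :=
  ((Reduction.actTop (S := stack T T) (S' := idMPO ι) F X).reindex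
      (Equiv.prodAssoc χ χ α).symm (Equiv.punitProd α).symm).copy (funext (act_act T T X))
    (act_idMPO_submatrix X).symm (openTop F.left) (closeTop F.right) (openTop_eq _) (closeTop_eq _)

theorem fuseTop_right {T : ι → ι → Matrix χ χ ℂ} (F : FusionTensors T) (X : ι → Matrix α α ℂ) :
    (fuseTop F X).right = closeTop F.right := rfl

theorem fuseTop_left {T : ι → ι → Matrix χ χ ℂ} (F : FusionTensors T) (X : ι → Matrix α α ℂ) :
    (fuseTop F X).left = openTop F.left := rfl

theorem fuseTop_reduce {T : ι → ι → Matrix χ χ ℂ} (F : FusionTensors T) (X : ι → Matrix α α ℂ)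
    (e : ι → Matrix α β ℂ) (Y : ι → Matrix β β ℂ) (x y : List ι) (j : ι) :
    (openTop F.left : Matrix α (χ × (χ × α)) ℂ) *
      (word (act T (act T X)) x * act T (act T e) j * word (act T (act T Y)) y) *
      (closeTop F.right : Matrix (χ × (χ × β)) β ℂ) = word X x * e j * word Y y := by
  have h := Reduction.actTop_reduce (S := stack T T) (S' := idMPO ι) F X e Y x y j
  have h' := congrArg (fun M => M.submatrix (Equiv.punitProd α).symm (Equiv.punitProd β).symm) h
  rw [openTop_eq, closeTop_eq, funext (act_act T T X), funext (act_act T T e),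
    funext (act_act T T Y), word_submatrix, word_submatrix, Matrix.submatrix_mul_equiv,
    Matrix.submatrix_mul_equiv, Matrix.submatrix_mul_equiv, Matrix.submatrix_mul_equiv]
  refine h'.trans ?_
  rw [← Matrix.submatrix_mul_equiv _ _ _ (Equiv.punitProd β).symm,
    ← Matrix.submatrix_mul_equiv _ _ _ (Equiv.punitProd α).symm, ← word_submatrix,
    ← word_submatrix, act_idMPO_submatrix, act_idMPO_submatrix, act_idMPO,
    Matrix.submatrix_submatrix]
  simp

end Lift

end Layers

/-! ### Long reductions and uniqueness up to a scalar -/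

section Phase

open scoped Kronecker

variable {ι α β γ δ : Type*}

theorem exists_split (w : List ι) (a b : ℕ) (h : a + b ≤ w.length) :
    ∃ u v t : List ι, w = u ++ (v ++ t) ∧ u.length = a ∧ t.length = b ∧
      v.length + (a + b) = w.length := by
  refine ⟨w.take a, (w.drop a).take (w.length - a - b), (w.drop a).drop (w.length - a - b), ?_, ?_,
    ?_, ?_⟩
  · simp only [List.take_append_drop]
  all_goals simp
  all_goals omega

variable [Fintype α] [DecidableEq α] [Fintype β] [DecidableEq β] [Fintype γ] [DecidableEq γ]

theorem IsInjective.span_words [Fintype ι] {Y : ι → Matrix α α ℂ} (hY : IsInjective Y) (n : ℕ) :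
    Submodule.span ℂ {M | ∃ w : List ι, w.length = n + 1 ∧ word Y w = M} = ⊤ := by
  induction n with
  | zero =>
    rw [← hY.span_range]
    congr 1
    ext M
    constructor
    · rintro ⟨w, hw, rfl⟩
      obtain ⟨i, rfl⟩ := List.length_eq_one_iff.1 hw
      exact ⟨i, by simp [word]⟩
    · rintro ⟨i, rfl⟩
      exact ⟨[i], rfl, by simp [word]⟩
  | succ n ih =>
    refine eq_top_iff.2 fun M _ => ?_
    have h : M ∈ (⊤ : Submodule ℂ (Matrix α α ℂ)) * ⊤ := by
      rw [← mul_one M]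
      exact Submodule.mul_mem_mul Submodule.mem_top Submodule.mem_top
    nth_rw 1 [← hY.span_range] at h
    rw [← ih, Submodule.span_mul_span] at h
    refine Submodule.span_mono ?_ h
    rintro _ ⟨_, ⟨i, rfl⟩, _, ⟨w, hw, rfl⟩, rfl⟩
    exact ⟨i :: w, by simp [hw], word_cons _ _ _⟩

/-- Linear identities that hold for all words of a fixed positive length hold for all matrices. -/
theorem IsInjective.eq_of_words [Fintype ι] {Y : ι → Matrix α α ℂ} (hY : IsInjective Y) {n : ℕ}
    {M : Type*} [AddCommGroup M] [Module ℂ M] {f g : Matrix α α ℂ →ₗ[ℂ] M}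
    (h : ∀ w : List ι, w.length = n + 1 → f (word Y w) = g (word Y w)) : f = g :=
  LinearMap.ext_on (hY.span_words n) (by rintro _ ⟨w, hw, rfl⟩; exact h w hw)

theorem IsInjective.exists_word_ne_zero [Fintype ι] [Nonempty α] {Y : ι → Matrix α α ℂ}
    (hY : IsInjective Y) (n : ℕ) : ∃ w : List ι, w.length = n + 1 ∧ word Y w ≠ 0 := by
  by_contra! hcon
  have h : (LinearMap.id : Matrix α α ℂ →ₗ[ℂ] _) = 0 := hY.eq_of_words (n := n) hcon
  exact one_ne_zero (α := Matrix α α ℂ) (LinearMap.congr_fun h 1)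

/-- The defining properties of a reduction for strings longer than a margin `m`. -/
structure IsLongReduction (X : ι → Matrix β β ℂ) (Y : ι → Matrix α α ℂ) (L : Matrix α β ℂ)
    (R : Matrix β α ℂ) (m : ℕ) : Prop where
  reduce : ∀ w : List ι, L * word X w * R = word Y w
  replace : ∀ u w v : List ι, m ≤ u.length → m ≤ w.length → m ≤ v.length →
    word X u * word X w * word X v = word X u * (R * word Y w * L) * word X v

variable {X : ι → Matrix β β ℂ} {Y : ι → Matrix α α ℂ} {Z : ι → Matrix γ γ ℂ}

theorem Reduction.isLongReduction (r : Reduction X Y) : IsLongReduction X Y r.left r.right 1 where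
  reduce := r.reduce
  replace u w v hu hw hv := by
    obtain ⟨u, i, rfl⟩ := List.eq_nil_or_concat' u |>.resolve_left (by rintro rfl; simp at hu)
    obtain ⟨j, v, rfl⟩ := List.exists_cons_of_length_pos hv
    have h := r.replace i j w (by rintro rfl; simp at hw)
    have h' := congrArg (fun M => word X u * M * word X v) h
    simpa only [word_append, word_cons, word_nil, Matrix.mul_one, Matrix.mul_assoc] using h'

section

variable {L : Matrix α β ℂ} {R : Matrix β α ℂ} {m : ℕ}

/-- The last `m` letters of `w` serve as the right margin for the replacement; `reduce` then absorbs
them, together with `R`, into `Y`. -/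
theorem IsLongReduction.mul_right (h : IsLongReduction X Y L R m) {u w : List ι}
    (hu : m ≤ u.length) (hw : 2 * m ≤ w.length) :
    word X u * word X w * R = word X u * R * word Y w := by
  obtain ⟨_, w, v, rfl, h0, hv, hwl⟩ := exists_split w 0 m (by omega)
  obtain rfl := List.length_eq_zero_iff.1 h0
  rw [List.nil_append, word_append, word_append, ← Matrix.mul_assoc,
    h.replace u w v hu (by simp at hw hwl; omega) hv.ge]
  simp only [Matrix.mul_assoc, ← h.reduce v]

theorem IsLongReduction.mul_left (h : IsLongReduction X Y L R m) {u w : List ι}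
    (hu : m ≤ u.length) (hw : 2 * m ≤ w.length) :
    L * word X w * word X u = word Y w * L * word X u := by
  obtain ⟨v, w, _, rfl, hv, h0, hwl⟩ := exists_split w m 0 (by omega)
  obtain rfl := List.length_eq_zero_iff.1 h0
  rw [List.append_nil, word_append, word_append, Matrix.mul_assoc,
    h.replace v w u hv.ge (by simp at hw hwl; omega) hu, ← h.reduce v]
  simp only [Matrix.mul_assoc]

end

/-- The inner reduction needs margins in the intermediate tensor `Z`, and the outer one needs
margins in `X` to move its end tensors past these. One outer and two inner letters per side suffice,
whence the margin `3`; this is why composites are handled as long reductions. -/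
theorem Reduction.comp_isLongReduction (r : Reduction X Z) (s : Reduction Z Y) :
    IsLongReduction X Y (s.left * r.left) (r.right * s.right) 3 where
  reduce w := by
    rw [← s.reduce, ← r.reduce]
    simp only [Matrix.mul_assoc]
  replace u w v hu hw hv := by
    obtain ⟨_, a, b, rfl, h0, hb, ha⟩ := exists_split u 0 2 (by omega)
    obtain ⟨c, d, _, rfl, hc, h0', hd⟩ := exists_split v 2 0 (by omega)
    obtain rfl := List.length_eq_zero_iff.1 h0
    obtain rfl := List.length_eq_zero_iff.1 h0'
    simp only [List.nil_append, List.append_nil] at *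
    have h1 := r.isLongReduction.replace a (b ++ (w ++ c)) d (by omega) (by simp; omega) (by omega)
    have h2 := s.isLongReduction.replace b w c (by omega) (by omega) (by omega)
    have h3 := r.isLongReduction.mul_right (u := a) (w := b) (by omega) (by omega)
    have h4 := r.isLongReduction.mul_left (u := d) (w := c) (by omega) (by omega)
    have h5 : word Z (b ++ (w ++ c)) = word Z b * (s.right * word Y w * s.left) * word Z c := by
      rw [word_append, word_append, ← h2, Matrix.mul_assoc]
    rw [h5] at h1
    calc word X (a ++ b) * word X w * word X (c ++ d)
        = word X a * word X (b ++ (w ++ c)) * word X d := by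
          simp only [word_append, Matrix.mul_assoc]
      _ = (word X a * r.right * word Z b) * (s.right * word Y w * s.left) *
            (word Z c * r.left * word X d) := by
          rw [h1]; simp only [Matrix.mul_assoc]
      _ = word X (a ++ b) * (r.right * s.right * word Y w * (s.left * r.left)) *
            word X (c ++ d) := by
          rw [← h3, ← h4]; simp only [word_append, Matrix.mul_assoc]

/-- A matrix unit in place of `M` separates the two factors, and a nonzero entry of `P` can be
divided out. -/
theorem exists_smul_eq_of_mul_mul {κ : Type*} {P Q : Matrix α α ℂ} (hP : P ≠ 0)
    {p q : κ → Matrix α α ℂ} (h : ∀ (M : Matrix α α ℂ) k, P * M * q k = Q * M * p k) :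
    ∃ c : ℂ, ∀ k, q k = c • p k := by
  obtain ⟨a, b, hab⟩ : ∃ a b, P a b ≠ 0 := by
    by_contra! hcon
    exact hP (Matrix.ext hcon)
  refine ⟨Q a b / P a b, fun k => Matrix.ext fun c d => ?_⟩
  have h1 := congrFun (congrFun (h (Matrix.single b c 1) k) a) d
  have h2 : ∀ N N' : Matrix α α ℂ, (N * Matrix.single b c 1 * N' : Matrix α α ℂ) a d = N a b * N' c d := by
    intro N N'
    simp [Matrix.mul_apply, Matrix.single_apply, ite_and, Finset.sum_ite_eq]
  rw [h2, h2] at h1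
  rw [Matrix.smul_apply, smul_eq_mul, div_mul_eq_mul_div, eq_div_iff hab, ← h1, mul_comm]

theorem exists_smul_eq_of_mul_mul' {κ : Type*} {P Q : Matrix α α ℂ} (hP : P ≠ 0)
    {p q : κ → Matrix α α ℂ} (h : ∀ (M : Matrix α α ℂ) k, q k * M * P = p k * M * Q) :
    ∃ c : ℂ, ∀ k, q k = c • p k := by
  obtain ⟨c, hc⟩ := exists_smul_eq_of_mul_mul (P := P.transpose) (Q := Q.transpose)
    (p := fun k => (p k).transpose) (q := fun k => (q k).transpose)
    (fun h0 => hP (Matrix.transpose_injective (by simpa using h0))) (fun M k => by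
      rw [← M.transpose_transpose, ← Matrix.transpose_mul, ← Matrix.transpose_mul,
        ← Matrix.transpose_mul, ← Matrix.transpose_mul, ← Matrix.mul_assoc, ← Matrix.mul_assoc, h])
  exact ⟨c, fun k => Matrix.transpose_injective (by simpa using hc k)⟩

variable {L : Matrix α β ℂ} {R : Matrix β α ℂ} {m : ℕ}

/-- Two reductions to the same injective tensor agree up to a phase. -/
theorem Reduction.exists_phase [Fintype ι] [Nonempty α] (hY : IsInjective Y) (r : Reduction X Y)
    (h : IsLongReduction X Y L R m) :
    ∃ c : ℂ, c ≠ 0 ∧ (∀ w : List ι, w ≠ [] → r.left * word X w * R = c • word Y w) ∧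
      (∀ w : List ι, 3 ≤ w.length → word X w * R = c • (word X w * r.right)) ∧
      ∀ w : List ι, 3 ≤ w.length → r.left * word X w = c • (L * word X w) := by
  have hr := r.isLongReduction
  obtain ⟨u, hu, hu0⟩ := hY.exists_word_ne_zero m
  have hpos : ∀ w : List ι, w ≠ [] → 1 ≤ w.length := fun w hw => List.length_pos_iff.2 hw
  -- One mixed string on `u ++ v ++ w` is reduced twice: by `r` around `v`, or by moving `R` through
  -- `v ++ w`. The words `v` of length `2 * m + 1` span all matrices, so `v` may be any matrix.
  obtain ⟨c, hc⟩ : ∃ c : ℂ, ∀ w : {w : List ι // w ≠ []},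
      r.left * word X w * R = c • word Y w := by
    refine exists_smul_eq_of_mul_mul hu0 (Q := r.left * word X u * R) fun M ⟨w, hw⟩ => ?_
    have key : LinearMap.mulRight ℂ (r.left * word X w * R) ∘ₗ LinearMap.mulLeft ℂ (word Y u) =
        LinearMap.mulRight ℂ (word Y w) ∘ₗ LinearMap.mulLeft ℂ (r.left * word X u * R) := by
      refine hY.eq_of_words (n := 2 * m) fun v hv => ?_
      simp only [LinearMap.comp_apply, LinearMap.mulLeft_apply, LinearMap.mulRight_apply]
      have h1 := hr.replace u v w (by omega) (by omega) (hpos w hw)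
      have h2 := h.mul_right (u := u) (w := v ++ w) (by omega) (by simp; omega)
      calc word Y u * word Y v * (r.left * word X w * R)
          = r.left * (word X u * (r.right * word Y v * r.left) * word X w) * R := by
            rw [← r.reduce u]; simp only [Matrix.mul_assoc]
        _ = r.left * (word X u * word X (v ++ w) * R) := by
            rw [← h1, word_append]; simp only [Matrix.mul_assoc]
        _ = r.left * word X u * R * word Y v * word Y w := by
            rw [h2, word_append]; simp only [Matrix.mul_assoc]
    exact LinearMap.congr_fun key M
  obtain ⟨d, hd⟩ : ∃ d : ℂ, ∀ w : {w : List ι // w ≠ []},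
      L * word X w * r.right = d • word Y w := by
    refine exists_smul_eq_of_mul_mul' hu0 (Q := L * word X u * r.right) fun M ⟨w, hw⟩ => ?_
    have key : LinearMap.mulRight ℂ (word Y u) ∘ₗ LinearMap.mulLeft ℂ (L * word X w * r.right) =
        LinearMap.mulRight ℂ (L * word X u * r.right) ∘ₗ LinearMap.mulLeft ℂ (word Y w) := by
      refine hY.eq_of_words (n := 2 * m) fun v hv => ?_
      simp only [LinearMap.comp_apply, LinearMap.mulLeft_apply, LinearMap.mulRight_apply]
      have h1 := hr.replace w v u (hpos w hw) (by omega) (by omega)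
      have h2 := h.mul_left (u := u) (w := w ++ v) (by omega) (by simp; omega)
      calc L * word X w * r.right * word Y v * word Y u
          = L * (word X w * (r.right * word Y v * r.left) * word X u) * r.right := by
            rw [← r.reduce u]; simp only [Matrix.mul_assoc]
        _ = L * word X (w ++ v) * word X u * r.right := by
            rw [← h1, word_append]; simp only [Matrix.mul_assoc]
        _ = word Y w * word Y v * (L * word X u * r.right) := by
            rw [h2, word_append]; simp only [Matrix.mul_assoc]
    exact LinearMap.congr_fun key M
  -- Replacing the middle third of a string by the second reduction turns its outer thirds into the
  -- two mixed sandwiches, with factors `c` and `d`, while the total remains a word of `Y`.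
  have hcd : c * d = 1 := by
    obtain ⟨w, hw, hw0⟩ := hY.exists_word_ne_zero (3 * m + 2)
    obtain ⟨a, b, e, rfl, ha, he, hb⟩ := exists_split w (m + 1) (m + 1) (by omega)
    have h1 := h.replace a b e (by omega) (by omega) (by omega)
    have h2 : (c * d) • word Y (a ++ (b ++ e)) = word Y (a ++ (b ++ e)) := by
      calc (c * d) • word Y (a ++ (b ++ e))
          = (c • word Y a) * word Y b * (d • word Y e) := by
            simp only [word_append, smul_mul_assoc, mul_smul_comm, smul_smul, mul_assoc, mul_comm c d]
        _ = r.left * (word X a * (R * word Y b * L) * word X e) * r.right := by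
            rw [← hc ⟨a, by rintro rfl; simp at ha⟩, ← hd ⟨e, by rintro rfl; simp at he⟩]
            simp only [Matrix.mul_assoc]
        _ = word Y (a ++ (b ++ e)) := by
            rw [← h1, ← r.reduce]; simp only [word_append, Matrix.mul_assoc]
    have h3 : (c * d - 1) • word Y (a ++ (b ++ e)) = 0 := by rw [sub_smul, h2, one_smul, sub_self]
    exact sub_eq_zero.1 ((smul_eq_zero.1 h3).resolve_right hw0)
  refine ⟨c, left_ne_zero_of_mul_eq_one hcd, fun w hw => hc ⟨w, hw⟩, fun w hw => ?_,
    fun w hw => ?_⟩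
  -- Replacing all but the two end letters turns the comparison of right tensors into a comparison
  -- of `r.left * word X e * Q`, which is already known.
  · obtain ⟨a, b, e, rfl, ha, he, hb⟩ := exists_split w 1 1 (by omega)
    have h1 := hr.replace a b e (by omega) (by omega) (by omega)
    have h2 := hc ⟨e, by rintro rfl; simp at he⟩
    have h3 : ∀ Q : Matrix β α ℂ, word X (a ++ (b ++ e)) * Q =
        word X a * r.right * word Y b * (r.left * word X e * Q) := by
      intro Q
      simp only [word_append, ← Matrix.mul_assoc]
      rw [h1]
      simp only [Matrix.mul_assoc]
    rw [h3, h3, h2, r.reduce, Matrix.mul_smul]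
  · obtain ⟨a, b, e, rfl, ha, he, hb⟩ := exists_split w 1 1 (by omega)
    have h1 := hr.replace a b e (by omega) (by omega) (by omega)
    have h2 := hd ⟨a, by rintro rfl; simp at ha⟩
    have h3 : ∀ Q : Matrix α β ℂ, Q * word X (a ++ (b ++ e)) =
        (Q * word X a * r.right) * word Y b * r.left * word X e := by
      intro Q
      simp only [word_append]
      rw [← Matrix.mul_assoc (word X a), h1]
      simp only [Matrix.mul_assoc]
    rw [h3, h3, h2, r.reduce]
    simp only [Matrix.smul_mul, smul_smul, hcd, one_smul]

end Phase

/-! ### The MPO read as a state; the anomaly phase -/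

section Anomaly

open scoped Kronecker

set_option linter.unusedSectionVars false

variable {ι χ χ' α β γ δ : Type*} [Fintype ι] [DecidableEq ι]
variable [Fintype χ] [DecidableEq χ] [Fintype χ'] [DecidableEq χ'] [Fintype α] [DecidableEq α]
  [Fintype β] [DecidableEq β] [Fintype γ] [DecidableEq γ] [Fintype δ] [DecidableEq δ]

theorem ite_zero_apply {m n : Type*} (p : Prop) [Decidable p] (M : Matrix m n ℂ) (a : m) (b : n) :
    (if p then M else 0) a b = if p then M a b else 0 := by split_ifs <;> rfl

/-- The MPO tensor acting as `T` on the first factor and as the identity on the second. -/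
def leftMul (T : ι → ι → Matrix χ χ ℂ) : ι × ι → ι × ι → Matrix χ χ ℂ :=
  fun p q => if p.2 = q.2 then T p.1 q.1 else 0

/-- The vectorization of `leftMul` in terms of that of the original tensor. -/
def spread (X : ι × ι → Matrix α α ℂ) : (ι × ι) × (ι × ι) → Matrix α α ℂ :=
  fun p => if p.1.2 = p.2.2 then X (p.1.1, p.2.1) else 0

theorem vec_leftMul (T : ι → ι → Matrix χ χ ℂ) : vec (leftMul T) = spread (vec T) := rfl

theorem stack_leftMul (T : ι → ι → Matrix χ χ ℂ) (S : ι → ι → Matrix χ' χ' ℂ) :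
    stack (leftMul T) (leftMul S) = leftMul (stack T S) := by
  funext ⟨i, k⟩ ⟨j, l⟩
  simp only [stack, act, leftMul, Fintype.sum_prod_type]
  ext a b
  by_cases hkl : k = l
  · subst hkl
    simp [Matrix.sum_apply, ite_zero_apply]
  · simp only [Matrix.sum_apply, Matrix.kroneckerMap_apply, hkl, if_false, Matrix.zero_apply]
    refine Finset.sum_eq_zero fun x _ => Finset.sum_eq_zero fun y _ => ?_
    by_cases hky : k = y
    · subst hky; simp [hkl]
    · simp [hky]

/-- This bridge makes statements about MPS tensors apply to stacks of MPOs: multiplication from the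
left is the action of `T ⊗ 1` on the vectorized operator. -/
theorem vec_stack (T : ι → ι → Matrix χ χ ℂ) (S : ι → ι → Matrix χ' χ' ℂ) :
    vec (stack T S) = act (leftMul T) (vec S) := by
  funext ⟨i, k⟩
  ext a b
  simp [vec, stack, act, leftMul, Fintype.sum_prod_type, Matrix.sum_apply, ite_zero_apply]

theorem idTensor_prod : (idTensor (ι := ι × ι)) = spread (idTensor (ι := ι)) := by
  funext ⟨⟨i, k⟩, ⟨j, l⟩⟩
  by_cases hij : i = j <;> by_cases hkl : k = l <;> simp [idTensor, spread, hij, hkl]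

theorem word_spread (X : ι × ι → Matrix α α ℂ) (w : List ((ι × ι) × (ι × ι))) :
    word (spread X) w = if ∀ p ∈ w, p.1.2 = p.2.2 then
      word X (w.map fun p => (p.1.1, p.2.1)) else 0 := by
  induction w with
  | nil => simp [word]
  | cons p w ih =>
    rw [word_cons, ih, List.map_cons, word_cons, spread]
    by_cases h : p.1.2 = p.2.2 <;> by_cases h' : ∀ p ∈ w, p.1.2 = p.2.2 <;> simp [h]

/-- Spreading of a reduction. -/
def Reduction.spread {X : ι × ι → Matrix α α ℂ} {Y : ι × ι → Matrix β β ℂ} (r : Reduction X Y) :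
    Reduction (spread X) (spread Y) where
  left := r.left
  right := r.right
  reduce w := by
    rw [word_spread, word_spread]
    split_ifs
    · exact r.reduce _
    · simp
  replace i j w hw := by
    rw [word_spread, word_spread, MPU.spread, MPU.spread]
    split_ifs
    · exact r.replace _ _ _ (by simpa using hw)
    all_goals simp

/-- Fusion tensors of `T` are fusion tensors of `T ⊗ 1`. -/
def leftMulFusion {T : ι → ι → Matrix χ χ ℂ} (F : FusionTensors T) : FusionTensors (leftMul T) :=
  (Reduction.spread F).copy (by rw [stack_leftMul, vec_leftMul]) idTensor_prod F.left F.right rfl rfl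

/-- Fusion of the upper two of three layers of an MPO. -/
def fuseUpper {T : ι → ι → Matrix χ χ ℂ} (F : FusionTensors T) :
    Reduction (vec (stack T (stack T T))) (vec T) :=
  (fuseTop (leftMulFusion F) (vec T)).copy (by rw [vec_stack, vec_stack]) rfl (openTop F.left)
    (closeTop F.right) rfl rfl

theorem act_leftMul_idTensor (T : ι → ι → Matrix χ χ ℂ) (p : ι × ι) :
    act (leftMul T) (idTensor (ι := ι)) p =
      (vec T p).submatrix (Equiv.prodPUnit χ) (Equiv.prodPUnit χ) := by
  obtain ⟨i, k⟩ := p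
  ext ⟨a, _⟩ ⟨b, _⟩
  simp [vec, idTensor, act, leftMul, Fintype.sum_prod_type, Matrix.sum_apply, ite_zero_apply]

/-- The trivial reduction. -/
def Reduction.refl (X : ι → Matrix α α ℂ) : Reduction X X where
  left := 1
  right := 1
  reduce w := by rw [Matrix.one_mul, Matrix.mul_one]
  replace i j w _ := by rw [Matrix.one_mul, Matrix.mul_one]

/-- The identity MPO below `T` can be dropped. -/
def dropIdentity (T : ι → ι → Matrix χ χ ℂ) :
    Reduction (act (leftMul T) (idTensor (ι := ι))) (vec T) :=
  ((Reduction.refl (vec T)).reindex (Equiv.prodPUnit χ) (Equiv.refl χ)).copy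
    (funext (act_leftMul_idTensor T)) (by simp) _ _ rfl rfl

/-- Fusion of the lower two of three layers of an MPO. -/
def fuseLower {T : ι → ι → Matrix χ χ ℂ} (F : FusionTensors T) :
    Reduction (vec (stack T (stack T T))) (vec T) :=
  ((Reduction.actBottom (Y := idTensor) F (leftMul T)).reindex (Equiv.refl _)
    (Equiv.prodPUnit χ).symm).copy (by rw [vec_stack T (stack T T)]; rfl)
    (by funext p; rw [act_leftMul_idTensor, Matrix.submatrix_submatrix]; simp)
    (((1 : Matrix χ χ ℂ) ⊗ₖ F.left).submatrix (Equiv.prodPUnit χ).symm id) (closeBottom F.right)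
    rfl (by ext ⟨a, b⟩ c; simp [closeBottom, Reduction.reindex, Reduction.actBottom])

theorem act_top_congr_left {S : ι → ι → Matrix χ χ ℂ} {P Q : Matrix χ' χ ℂ} {n : ℕ}
    (h : ∀ z : List (ι × ι), z.length = n → P * word (vec S) z = Q * word (vec S) z)
    (X : ι → Matrix α α ℂ) (w : List ι) (hw : w.length = n) :
    (P ⊗ₖ (1 : Matrix α α ℂ)) * word (act S X) w = (Q ⊗ₖ (1 : Matrix α α ℂ)) * word (act S X) w := by
  rw [word_act S X w n hw]
  simp only [Matrix.mul_sum, ← Matrix.mul_kronecker_mul]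
  refine Finset.sum_congr rfl fun v _ => ?_
  rw [h _ (by simp [hw])]

theorem openTop_congr {T : ι → ι → Matrix χ χ ℂ} {P Q : Matrix Unit (χ × χ) ℂ} {c : ℂ} {n : ℕ}
    (h : ∀ z : List (ι × ι), z.length = n →
      P * word (vec (stack T T)) z = c • (Q * word (vec (stack T T)) z))
    (X : ι → Matrix α α ℂ) (w : List ι) (hw : w.length = n) :
    (openTop P : Matrix α (χ × (χ × α)) ℂ) * word (act T (act T X)) w =
      c • ((openTop Q : Matrix α (χ × (χ × α)) ℂ) * word (act T (act T X)) w) := by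
  have h0 := act_top_congr_left (P := P) (Q := c • Q) (n := n)
    (fun z hz => by rw [h z hz, Matrix.smul_mul]) X w hw
  rw [openTop_eq, openTop_eq, funext (act_act T T X), word_submatrix, Matrix.submatrix_mul_equiv,
    Matrix.submatrix_mul_equiv, h0, Matrix.smul_kronecker, Matrix.smul_mul]
  rfl

theorem act_top_compress {S : ι → ι → Matrix χ χ ℂ} {S' : ι → ι → Matrix χ' χ' ℂ}
    {P : Matrix χ' χ ℂ} {Q : Matrix χ χ' ℂ} {c : ℂ}
    (h : ∀ z : List (ι × ι), z ≠ [] → P * word (vec S) z * Q = c • word (vec S') z)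
    (X : ι → Matrix α α ℂ) (w : List ι) (hw : w ≠ []) :
    (P ⊗ₖ (1 : Matrix α α ℂ)) * word (act S X) w * (Q ⊗ₖ (1 : Matrix α α ℂ)) =
      c • word (act S' X) w := by
  rw [word_act S X w _ rfl, word_act S' X w _ rfl]
  simp only [Matrix.mul_sum, Matrix.sum_mul, ← Matrix.mul_kronecker_mul, Finset.smul_sum]
  refine Finset.sum_congr rfl fun v _ => ?_
  rw [h _ (zip_ofFn_ne_nil hw v), Matrix.one_mul, Matrix.mul_one, Matrix.smul_kronecker]

/-- The phase relating the two fusions holds on strings of every positive length. -/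
def IsPhase (T : ι → ι → Matrix χ χ ℂ) (F : FusionTensors T) (ω : ℂ) : Prop :=
  ∀ w : List (ι × ι), w ≠ [] →
    (openTop F.left : Matrix χ (χ × (χ × χ)) ℂ) * word (vec (stack T (stack T T))) w *
      closeBottom F.right = ω • word (vec T) w

/-- `fuseUpper` and `fuseLower` both reduce `TTT` to the injective tensor `T`; the phase is the
scalar by which they differ. -/
theorem exists_isPhase [Nonempty χ] {T : ι → ι → Matrix χ χ ℂ} (hT : IsInjective (vec T))
    (F : FusionTensors T) : ∃ ω : ℂ, ω ≠ 0 ∧ IsPhase T F ω := by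
  obtain ⟨c, hc, h, -⟩ := (fuseUpper F).exists_phase hT (fuseLower F).isLongReduction
  exact ⟨c, hc, h⟩

theorem isInjective_idTensor [Nonempty ι] : IsInjective (idTensor (ι := ι)) := by
  obtain ⟨o⟩ := ‹Nonempty ι›
  refine ⟨fun p => if p = (o, o) then 1 else 0, fun a b a' b' => ?_⟩
  simp only [idTensor, ite_zero_apply]
  rw [Finset.sum_eq_single (o, o)]
  · simp
  · intro c _ hc
    simp [hc]
  · simp

/-- A change of fusion tensors rescales the right one by `c` and the left one by its inverse; the
phase contains one of each. -/
theorem IsPhase.eq_of_fusion [Nonempty ι] [Nonempty χ] {T : ι → ι → Matrix χ χ ℂ}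
    (hT : IsInjective (vec T)) {F F' : FusionTensors T} {ω ω' : ℂ} (h : IsPhase T F ω)
    (h' : IsPhase T F' ω') : ω = ω' := by
  obtain ⟨c, hc, -, hR, hL⟩ := Reduction.exists_phase isInjective_idTensor F
    (Reduction.isLongReduction F')
  obtain ⟨w, hw, hw0⟩ := hT.exists_word_ne_zero 2
  have hne : w ≠ [] := by rintro rfl; simp at hw
  have h1 : word (vec (stack T (stack T T))) w * closeBottom F'.right =
      c • (word (vec (stack T (stack T T))) w * closeBottom F.right) := by
    have h0 := act_bottom_congr (P := F'.right) (Q := c • F.right) (n := 3)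
      (fun z hz => by rw [hR z hz.ge, Matrix.mul_smul]) (leftMul T) w hw
    rw [Matrix.kronecker_smul, Matrix.mul_smul, ← vec_stack T (stack T T)] at h0
    exact Matrix.ext fun a b => congrFun (congrFun h0 a) (b, ())
  have h2 : (openTop F.left : Matrix χ (χ × (χ × χ)) ℂ) * word (vec (stack T (stack T T))) w =
      c • ((openTop F'.left : Matrix χ (χ × (χ × χ)) ℂ) *
        word (vec (stack T (stack T T))) w) := by
    have hX : vec (stack T (stack T T)) = act (leftMul T) (act (leftMul T) (vec T)) := by
      rw [vec_stack, vec_stack]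
    rw [hX]
    refine openTop_congr (n := 3) (fun z hz => ?_) (vec T) w hw
    rw [stack_leftMul, vec_leftMul, word_spread]
    split_ifs
    · exact hL _ (by simp [hz])
    · simp
  have h3 : c • (ω • word (vec T) w) = c • (ω' • word (vec T) w) := by
    rw [← h w hne, ← h' w hne, Matrix.mul_assoc, ← Matrix.mul_smul, ← h1, ← Matrix.mul_assoc, h2,
      Matrix.smul_mul]
  have h4 := smul_right_injective _ hc h3
  exact smul_left_injective ℂ hw0 h4

end Anomaly

/-! ### The `L`-symbols and their ratio -/

section LSymbol

open scoped Kronecker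

set_option linter.unusedSectionVars false

variable {ι χ χ' α β γ δ : Type*} [Fintype ι] [DecidableEq ι]
variable [Fintype χ] [DecidableEq χ] [Fintype χ'] [DecidableEq χ'] [Fintype α] [DecidableEq α]
  [Fintype β] [DecidableEq β] [Fintype γ] [DecidableEq γ] [Fintype δ] [DecidableEq δ]

theorem act_submatrix (T : ι → ι → Matrix χ χ ℂ) (X : ι → Matrix α α ℂ) (e : β ≃ α) (i : ι) :
    act T (fun k => (X k).submatrix e e) i =
      (act T X i).submatrix ((Equiv.refl χ).prodCongr e) ((Equiv.refl χ).prodCongr e) := by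
  ext ⟨a, b⟩ ⟨a', b'⟩
  simp [act, Matrix.sum_apply]

/-- Regrouping of three virtual lines above one. -/
def assocThree (χ α : Type*) : χ × (χ × (χ × α)) ≃ (χ × (χ × χ)) × α :=
  ((Equiv.refl χ).prodCongr (Equiv.prodAssoc χ χ α).symm).trans (Equiv.prodAssoc χ (χ × χ) α).symm

theorem act_act_act (T : ι → ι → Matrix χ χ ℂ) (X : ι → Matrix α α ℂ) :
    act T (act T (act T X)) = fun i => (act (stack T (stack T T)) X i).submatrix
      (assocThree χ α) (assocThree χ α) := by
  funext i
  rw [funext (act_act T T X), act_submatrix, act_act, Matrix.submatrix_submatrix]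
  rfl

theorem IsPhase.sandwich_act {T : ι → ι → Matrix χ χ ℂ} {F : FusionTensors T} {ω : ℂ} (h : IsPhase T F ω)
    (X : ι → Matrix α α ℂ) (w : List ι) (hw : w ≠ []) :
    (openTop F.left : Matrix (χ × α) (χ × (χ × (χ × α))) ℂ) *
        word (MPU.act T (MPU.act T (MPU.act T X))) w *
        ((1 : Matrix χ χ ℂ) ⊗ₖ (closeTop F.right : Matrix (χ × (χ × α)) α ℂ)) =
      ω • word (MPU.act T X) w := by
  have h0 := act_top_compress h X w hw
  have h1 : (openTop F.left : Matrix (χ × α) (χ × (χ × (χ × α))) ℂ) =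
      ((openTop F.left : Matrix χ (χ × (χ × χ)) ℂ) ⊗ₖ (1 : Matrix α α ℂ)).submatrix
        (Equiv.refl _) (assocThree χ α) := by
    ext ⟨a, b⟩ ⟨c, d, e, f⟩
    simp [openTop, assocThree, Matrix.one_apply, ite_and, Prod.ext_iff]
    split_ifs <;> rfl
  have h2 : ((1 : Matrix χ χ ℂ) ⊗ₖ (closeTop F.right : Matrix (χ × (χ × α)) α ℂ)) =
      ((closeBottom F.right : Matrix (χ × (χ × χ)) χ ℂ) ⊗ₖ (1 : Matrix α α ℂ)).submatrix
        (assocThree χ α) (Equiv.refl _) := by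
    ext ⟨a, b, c, d⟩ ⟨e, f⟩
    simp [closeTop, closeBottom, assocThree, mul_assoc]
  rw [h1, h2, act_act_act, word_submatrix, Matrix.submatrix_mul_equiv, Matrix.submatrix_mul_equiv,
    h0]
  rfl

/-- The two tensors act on disjoint layers, so their order is irrelevant. -/
theorem actBottom_mul_closeTop (v : Matrix (χ × χ) Unit ℂ) (W : Matrix (χ × α) β ℂ) :
    ((1 : Matrix χ χ ℂ) ⊗ₖ actBottom W) * (closeTop v : Matrix (χ × (χ × β)) β ℂ) =
      (closeTop v : Matrix (χ × (χ × (χ × α))) (χ × α) ℂ) * W := by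
  ext ⟨a, b, c, d⟩ e
  simp [Matrix.mul_apply, Fintype.sum_prod_type, actBottom, closeTop, Matrix.one_apply, ite_and,
    Prod.ext_iff, mul_comm]

variable {T : ι → ι → Matrix χ χ ℂ} {A : ι → Matrix α α ℂ} {B : ι → Matrix β β ℂ}

/-- `TTA` reduces to `A` by fusing the layers or by absorbing them successively. The same number
appears at the right end and, with the roles of the two reductions interchanged, at the left end;
the wall argument needs both. -/
theorem exists_lsymbol [Nonempty α] (hA : IsInjective A) (F : FusionTensors T)
    (WB : ActionTensors T A B) (WA : ActionTensors T B A) : ∃ L : ℂ, L ≠ 0 ∧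
      (∀ w : List ι, 3 ≤ w.length →
        word (act T (act T A)) w * (closeTop F.right : Matrix (χ × (χ × α)) α ℂ) =
          L • (word (act T (act T A)) w * (actBottom WB.right * WA.right))) ∧
      ∀ w : List ι, 3 ≤ w.length →
        WA.left * ((1 : Matrix χ χ ℂ) ⊗ₖ WB.left) * word (act T (act T A)) w =
          L • ((openTop F.left : Matrix α (χ × (χ × α)) ℂ) * word (act T (act T A)) w) := by
  obtain ⟨c, hc, -, hR, hL⟩ := (fuseTop F A).exists_phase hA
    ((Reduction.actBottom WB T).comp_isLongReduction WA)
  refine ⟨c⁻¹, inv_ne_zero hc, fun w hw => ?_, fun w hw => ?_⟩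
  · exact (eq_inv_smul_iff₀ hc).2 (hR w hw).symm
  · exact (eq_inv_smul_iff₀ hc).2 (hL w hw).symm

/-- Closing the left end with the successive action tensors turns the right-hand string into a word
of `A`, and some word of length three is nonzero. -/
theorem lsymbol_unique [Nonempty α] (hA : IsInjective A) (F : FusionTensors T)
    (WB : ActionTensors T A B) (WA : ActionTensors T B A) {L : ℂ}
    (hL : ∀ w : List ι, 3 ≤ w.length →
        word (act T (act T A)) w * (closeTop F.right : Matrix (χ × (χ × α)) α ℂ) =
          L • (word (act T (act T A)) w * (actBottom WB.right * WA.right))) (x : ℂ) :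
    IsLSymbol T A B F WB WA x ↔ x = L := by
  refine ⟨fun hx => ?_, ?_⟩
  · obtain ⟨w, hw, hw0⟩ := hA.exists_word_ne_zero 2
    have h1 := (hx w hw).symm.trans (hL w hw.ge)
    have h2 := congrArg (fun M => WA.left * ((1 : Matrix χ χ ℂ) ⊗ₖ WB.left) * M) h1
    have h3 := ((Reduction.actBottom WB T).comp_isLongReduction WA).reduce w
    have h4 : WA.left * ((1 : Matrix χ χ ℂ) ⊗ₖ WB.left) *
        (word (act T (act T A)) w * (actBottom WB.right * WA.right)) = word A w :=
      (Matrix.mul_assoc _ _ _).symm.trans h3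
    simp only [Matrix.mul_smul, h4] at h2
    exact smul_left_injective ℂ hw0 h2
  · rintro rfl w hw
    exact hL w hw.ge

/-- The ratio of the `L`-symbols is the anomaly phase. -/
theorem lsymbol_eq_phase_mul [Nonempty β] (hB : IsInjective B) {F : FusionTensors T} {ω : ℂ}
    (hω : IsPhase T F ω) (WB : ActionTensors T A B) (WA : ActionTensors T B A) {LA LB : ℂ}
    (hLA : ∀ w : List ι, 3 ≤ w.length →
        word (act T (act T A)) w * (closeTop F.right : Matrix (χ × (χ × α)) α ℂ) =
          LA • (word (act T (act T A)) w * (actBottom WB.right * WA.right)))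
    (hLB : ∀ w : List ι, 3 ≤ w.length →
        word (act T (act T B)) w * (closeTop F.right : Matrix (χ × (χ × β)) β ℂ) =
          LB • (word (act T (act T B)) w * (actBottom WA.right * WB.right))) :
    LA = ω * LB := by
  obtain ⟨w, hw, hw0⟩ := hB.exists_word_ne_zero 3
  -- Four sites: three for the relation defining `LB`, and one more as the margin for moving the
  -- lowest action tensor to the left through them.
  obtain ⟨a, v, b, rfl, ha, hb, hwl⟩ := exists_split w 1 3 (by omega)
  obtain rfl : v = [] := List.length_eq_zero_iff.1 (by omega)
  rw [List.nil_append] at hw hw0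
  have hne : a ++ b ≠ [] := by rintro h; rw [h] at hw; simp at hw
  set X := act T (act T (act T A)) with hX
  have h1 : word X (a ++ b) * ((1 : Matrix χ χ ℂ) ⊗ₖ (closeTop F.right : Matrix (χ × (χ × α)) α ℂ)) =
      LA • (word X (a ++ b) * ((1 : Matrix χ χ ℂ) ⊗ₖ actBottom WB.right) * actBottom WA.right) := by
    have h := act_bottom_congr (P := (closeTop F.right : Matrix (χ × (χ × α)) α ℂ))
      (Q := LA • (actBottom WB.right * WA.right)) (n := 4)
      (fun z hz => by rw [hLA z (by omega), Matrix.mul_smul]) T (a ++ b) hw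
    rw [h, Matrix.kronecker_smul, Matrix.mul_smul, Matrix.mul_assoc, actBottom, actBottom,
      ← Matrix.mul_kronecker_mul, Matrix.one_mul]
  have h2 : LB • (word X (a ++ b) * ((1 : Matrix χ χ ℂ) ⊗ₖ actBottom WB.right) *
      actBottom WA.right * WB.right) =
      word X (a ++ b) * (closeTop F.right : Matrix (χ × (χ × (χ × α))) (χ × α) ℂ) * WB.right := by
    have h := ((Reduction.actBottom WB T).actBottom T).isLongReduction.mul_right (u := a) (w := b)
      (by omega) (by omega)
    change _ * ((1 : Matrix χ χ ℂ) ⊗ₖ actBottom WB.right) =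
      _ * ((1 : Matrix χ χ ℂ) ⊗ₖ actBottom WB.right) * _ at h
    rw [← word_append] at h
    have hb' := hLB b hb.ge
    calc LB • (word X (a ++ b) * ((1 : Matrix χ χ ℂ) ⊗ₖ actBottom WB.right) *
          actBottom WA.right * WB.right)
        = word X a * ((1 : Matrix χ χ ℂ) ⊗ₖ actBottom WB.right) *
            (LB • (word (act T (act T B)) b * (actBottom WA.right * WB.right))) := by
          rw [h, Matrix.mul_smul]; simp only [Matrix.mul_assoc, hX]
      _ = word X (a ++ b) * (((1 : Matrix χ χ ℂ) ⊗ₖ actBottom WB.right) *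
            (closeTop F.right : Matrix (χ × (χ × β)) β ℂ)) := by
          rw [← hb', ← Matrix.mul_assoc, ← h, Matrix.mul_assoc]
      _ = _ := by rw [actBottom_mul_closeTop, Matrix.mul_assoc]
  have h3 := hω.sandwich_act A (a ++ b) hne
  have h4 := (fuseTop F (act T A)).reduce (a ++ b)
  -- The left end always fuses the upper two layers and then acts. At the right end, fusing the
  -- middle layers gives `ω`, and rewriting that fusion by `h1` and `h2` gives `LA / LB`.
  have h5 : (LB * ω) • word B (a ++ b) = LA • word B (a ++ b) := by
    calc (LB * ω) • word B (a ++ b)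
        = LB • (WB.left * ((openTop F.left : Matrix (χ × α) (χ × (χ × (χ × α))) ℂ) *
            (word X (a ++ b) * ((1 : Matrix χ χ ℂ) ⊗ₖ
              (closeTop F.right : Matrix (χ × (χ × α)) α ℂ)))) * WB.right) := by
          rw [← Matrix.mul_assoc _ _ ((1 : Matrix χ χ ℂ) ⊗ₖ _), h3, ← WB.reduce, mul_smul,
            Matrix.mul_smul, Matrix.smul_mul]
      _ = LA • (WB.left * (openTop F.left : Matrix (χ × α) (χ × (χ × (χ × α))) ℂ) *
            (LB • (word X (a ++ b) * ((1 : Matrix χ χ ℂ) ⊗ₖ actBottom WB.right) *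
      actBottom WA.right * WB.right))) := by
          rw [h1]
          simp only [Matrix.mul_smul, Matrix.smul_mul, smul_smul, Matrix.mul_assoc, mul_comm LA]
      _ = LA • word B (a ++ b) := by
          rw [h2, ← WB.reduce, ← h4]
          simp only [Matrix.mul_assoc, fuseTop_left, fuseTop_right, hX]
  rw [mul_comm]
  exact (smul_left_injective ℂ hw0 h5).symm

theorem isPhase_leftMul {F : FusionTensors T} {ω : ℂ} (h : IsPhase T F ω) :
    IsPhase (leftMul T) (leftMulFusion F) ω := by
  intro w hw
  change (openTop F.left : Matrix χ (χ × (χ × χ)) ℂ) * _ * closeBottom F.right = _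
  rw [stack_leftMul, stack_leftMul, vec_leftMul, vec_leftMul, word_spread, word_spread]
  split_ifs
  · exact h _ (by simpa using hw)
  · simp

/-- The anomaly phase is a sign. -/
theorem IsPhase.mul_self [Nonempty ι] [Nonempty χ] (hT : IsInjective (vec T)) {F : FusionTensors T}
    {ω : ℂ} (h : IsPhase T F ω) : ω * ω = 1 := by
  -- `T ⊗ 1` exchanges the states `vec T` and `idTensor`, with action tensors `F` and the removal of
  -- a trivial line. Above `idTensor` the successive action is literally `F`, so `LB = 1`; above
  -- `vec T` it is fusion of the lower two layers, so `LA * ω = 1`.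
  let WB : ActionTensors (leftMul T) (vec T) idTensor :=
    Reduction.copy F (vec_stack T T).symm rfl F.left F.right rfl rfl
  let WA : ActionTensors (leftMul T) idTensor (vec T) := dropIdentity T
  have hid := isInjective_idTensor (ι := ι)
  obtain ⟨LA, -, hLA, -⟩ := exists_lsymbol hT (leftMulFusion F) WB WA
  obtain ⟨LB, -, hLB, -⟩ := exists_lsymbol hid (leftMulFusion F) WA WB
  have hrel := lsymbol_eq_phase_mul hid (isPhase_leftMul h) WB WA hLA hLB
  have hB1 : LB = 1 := by
    obtain ⟨w, hw, hw0⟩ := hid.exists_word_ne_zero 2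
    have h1 := hLB w hw.ge
    have h2 : actBottom WA.right * WB.right =
        (closeTop F.right : Matrix (χ × (χ × Unit)) Unit ℂ) := by
      ext ⟨a, b, _⟩ _
      simp only [WA, WB, dropIdentity, Reduction.copy, Reduction.reindex, Reduction.refl, actBottom,
        closeTop]
      simp [Matrix.mul_apply, Fintype.sum_prod_type, Matrix.one_apply]
    have h3 := (fuseTop (leftMulFusion F) idTensor).reduce w
    rw [h2] at h1
    have h4 := congrArg (fun M => (openTop F.left : Matrix Unit (χ × (χ × Unit)) ℂ) * M) h1
    simp only [Matrix.mul_smul] at h4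
    have h5 : (openTop F.left : Matrix Unit (χ × (χ × Unit)) ℂ) *
        (word (act (leftMul T) (act (leftMul T) idTensor)) w *
          (closeTop F.right : Matrix (χ × (χ × Unit)) Unit ℂ)) =
          word idTensor w := (Matrix.mul_assoc _ _ _).symm.trans h3
    have h6 : (1 : ℂ) • word idTensor w = LB • word idTensor w := by
      rw [one_smul]; exact h5.symm.trans (h4.trans (congrArg _ h5))
    exact (smul_left_injective ℂ hw0 h6).symm
  have hA1 : LA * ω = 1 := by
    obtain ⟨w, hw, hw0⟩ := hT.exists_word_ne_zero 2
    have h1 := hLA w hw.ge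
    have h2 : actBottom WB.right * WA.right =
        (closeBottom F.right : Matrix (χ × (χ × χ)) χ ℂ) := by
      ext ⟨a, b, c⟩ d
      simp only [WA, WB, dropIdentity, Reduction.copy, Reduction.reindex, Reduction.refl, actBottom,
        closeBottom]
      simp [Matrix.mul_apply, Fintype.sum_prod_type, Matrix.one_apply]
    have h3 := (fuseTop (leftMulFusion F) (vec T)).reduce w
    have hX : vec (stack T (stack T T)) = act (leftMul T) (act (leftMul T) (vec T)) := by
      rw [vec_stack, vec_stack]
    have h7 : (openTop F.left : Matrix χ (χ × (χ × χ)) ℂ) *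
        word (act (leftMul T) (act (leftMul T) (vec T))) w * closeBottom F.right =
          ω • word (vec T) w := by
      rw [← h w (by rintro rfl; simp at hw)]
      exact congrArg (fun Z => (openTop F.left : Matrix χ (χ × (χ × χ)) ℂ) * word Z w *
        closeBottom F.right) hX.symm
    rw [h2] at h1
    have h4 := congrArg (fun M => (openTop F.left : Matrix χ (χ × (χ × χ)) ℂ) * M) h1
    simp only [Matrix.mul_smul, ← Matrix.mul_assoc] at h4
    have h6 : (1 : ℂ) • word (vec T) w = (LA * ω) • word (vec T) w := by
      rw [one_smul, mul_smul]; exact h3.symm.trans (h4.trans (congrArg _ h7))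
    exact (smul_left_injective ℂ hw0 h6).symm
  rw [hrel, hB1, mul_one] at hA1
  exact hA1

end LSymbol

/-! ### Domain walls: local factors -/

section Walls

open scoped Kronecker

set_option linter.unusedSectionVars false

variable {ι χ χ' α β γ δ : Type*} [Fintype ι] [DecidableEq ι]
variable [Fintype χ] [DecidableEq χ] [Fintype χ'] [DecidableEq χ'] [Fintype α] [DecidableEq α]
  [Fintype β] [DecidableEq β] [Fintype γ] [DecidableEq γ] [Fintype δ] [DecidableEq δ]
variable {T : ι → ι → Matrix χ χ ℂ} {A : ι → Matrix α α ℂ} {B : ι → Matrix β β ℂ}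

theorem word_singleton (X : ι → Matrix α α ℂ) (i : ι) : word X [i] = X i := by simp [word]

/-- The action tensors move inward through the extra letters until only the nearest neighbours of
the wall remain. Three sites per side are what the `L`-symbol relations require. -/
theorem IsWallFactor.words {WB : ActionTensors T A B} {WA : ActionTensors T B A}
    {eAB : ι → Matrix α β ℂ} {eBA : ι → Matrix β α ℂ} {c : ℂ}
    (h : IsWallFactor T A B WB WA eAB eBA c) (x y : List ι) (j : ι) (hx : x.length = 3)
    (hy : y.length = 3) :
    WB.left * (word (act T A) x * act T eAB j * word (act T B) y) * WA.right =
      c • (word B x * eBA j * word A y) := by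
  obtain ⟨_, u, i, rfl, h0, hi, hu⟩ := exists_split x 0 1 (by omega)
  obtain ⟨k, v, _, rfl, hk, h0', hv⟩ := exists_split y 1 0 (by omega)
  obtain rfl := List.length_eq_zero_iff.1 h0
  obtain rfl := List.length_eq_zero_iff.1 h0'
  obtain ⟨i, rfl⟩ := List.length_eq_one_iff.1 hi
  obtain ⟨k, rfl⟩ := List.length_eq_one_iff.1 hk
  rw [List.nil_append, List.append_nil] at *
  simp only [List.length_append, List.length_singleton] at hx hy
  have h1 := (Reduction.isLongReduction WB).mul_left (u := [i]) (w := u) (by simp) (by omega)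
  have h2 := (Reduction.isLongReduction WA).mul_right (u := [k]) (w := v) (by simp) (by omega)
  have h3 := h i j k
  rw [word_singleton] at h1 h2
  simp only [word_append, word_singleton]
  calc WB.left * (word (act T A) u * act T A i * act T eAB j * (act T B k * word (act T B) v)) *
        WA.right
      = (WB.left * word (act T A) u * act T A i) * act T eAB j *
          (act T B k * word (act T B) v * WA.right) := by simp only [Matrix.mul_assoc]
    _ = word B u * (WB.left * (act T A i * act T eAB j * act T B k) * WA.right) * word A v := by
        rw [h1, h2]; simp only [Matrix.mul_assoc]
    _ = c • (word B u * B i * eBA j * (A k * word A v)) := by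
        rw [h3]; simp only [Matrix.mul_assoc, Matrix.mul_smul, Matrix.smul_mul]

theorem IsInjective.forall_of_words (hA : IsInjective A) {n : ℕ} {p : Matrix α α ℂ → Prop}
    (h : ∀ w : List ι, w.length = n + 1 → p (word A w)) (h0 : p 0)
    (hadd : ∀ M N, p M → p N → p (M + N)) (hsmul : ∀ (c : ℂ) M, p M → p (c • M))
    (M : Matrix α α ℂ) : p M := by
  have hM : M ∈ Submodule.span ℂ {M | ∃ w : List ι, w.length = n + 1 ∧ word A w = M} :=
    hA.span_words n ▸ Submodule.mem_top
  induction hM using Submodule.span_induction with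
  | mem M hM => obtain ⟨w, hw, rfl⟩ := hM; exact h w hw
  | zero => exact h0
  | add M N _ _ hM hN => exact hadd M N hM hN
  | smul c M _ hM => exact hsmul c M hM

theorem exists_word_mul_word_ne_zero (hA : IsInjective A) (hB : IsInjective B) (m n : ℕ)
    {e : Matrix α β ℂ} (he : e ≠ 0) : ∃ x y : List ι, x.length = m + 1 ∧ y.length = n + 1 ∧
      word A x * e * word B y ≠ 0 := by
  by_contra! hcon
  refine he ?_
  have h1 : ∀ (M : Matrix α α ℂ) (y : List ι), y.length = n + 1 → M * e * word B y = 0 := by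
    intro M y hy
    refine hA.forall_of_words (n := m) (p := fun M => M * e * word B y = 0)
      (fun x hx => hcon x y hx hy) (by simp) (fun M N hM hN => ?_) (fun c M hM => ?_) M
    · rw [Matrix.add_mul, Matrix.add_mul, hM, hN, add_zero]
    · rw [Matrix.smul_mul, Matrix.smul_mul, hM, smul_zero]
  have h2 : ∀ N : Matrix β β ℂ, (1 : Matrix α α ℂ) * e * N = 0 := fun N => by
    refine hB.forall_of_words (n := n) (p := fun N => (1 : Matrix α α ℂ) * e * N = 0) (fun y hy => h1 1 y hy)
      (by simp) (fun M N hM hN => ?_) (fun c M hM => ?_) N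
    · rw [Matrix.mul_add, hM, hN, add_zero]
    · rw [Matrix.mul_smul, hM, smul_zero]
  simpa using h2 1

/-- The local factors of a pair of domain walls multiply to the ratio of the `L`-symbols. -/
theorem wallFactor_mul_wallFactor (hA : IsInjective A) (hB : IsInjective B) (F : FusionTensors T)
    (WB : ActionTensors T A B) (WA : ActionTensors T B A) {LA LB : ℂ} (hLB0 : LB ≠ 0)
    (hLA : ∀ w : List ι, 3 ≤ w.length →
        WA.left * ((1 : Matrix χ χ ℂ) ⊗ₖ WB.left) * word (act T (act T A)) w =
          LA • ((openTop F.left : Matrix α (χ × (χ × α)) ℂ) * word (act T (act T A)) w))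
    (hLB : ∀ w : List ι, 3 ≤ w.length →
        word (act T (act T B)) w * (closeTop F.right : Matrix (χ × (χ × β)) β ℂ) =
          LB • (word (act T (act T B)) w * (actBottom WA.right * WB.right)))
    {eAB : ι → Matrix α β ℂ} {eBA : ι → Matrix β α ℂ} (he : eAB ≠ 0) {cAB cBA : ℂ}
    (hAB : IsWallFactor T A B WB WA eAB eBA cAB) (hBA : IsWallFactor T B A WA WB eBA eAB cBA) :
    cBA * cAB = LA / LB := by
  obtain ⟨j, hj⟩ : ∃ j, eAB j ≠ 0 := by
    by_contra! hcon
    exact he (funext hcon)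
  obtain ⟨x, y, hx, hy, hne⟩ := exists_word_mul_word_ne_zero hA hB 2 2 hj
  have h1 := fuseTop_reduce F A eAB B x y j
  have h2 := hLA x hx.ge
  have h3 := hLB y hy.ge
  have h4 := act_bottom_compress (x := x) (y := y) (fun x' y' j hx' hy' =>
    hAB.words x' y' j (hx'.trans hx) (hy'.trans hy)) T j
  have h5 := hBA.words x y j hx hy
  have h6 : LA • (word A x * eAB j * word B y) =
      (LB * (cBA * cAB)) • (word A x * eAB j * word B y) := by
    calc LA • (word A x * eAB j * word B y)
        = (LA • ((openTop F.left : Matrix α (χ × (χ × α)) ℂ) * word (act T (act T A)) x)) *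
            act T (act T eAB) j * (word (act T (act T B)) y *
              (closeTop F.right : Matrix (χ × (χ × β)) β ℂ)) := by
          rw [← h1]; simp only [Matrix.mul_assoc, Matrix.smul_mul]
      _ = LB • (WA.left * ((((1 : Matrix χ χ ℂ) ⊗ₖ WB.left) * (word (act T (act T A)) x *
            act T (act T eAB) j * word (act T (act T B)) y) * ((1 : Matrix χ χ ℂ) ⊗ₖ WA.right)) *
              WB.right)) := by
          rw [← h2, h3, actBottom]; simp only [Matrix.mul_assoc, Matrix.mul_smul]
      _ = (LB * (cBA * cAB)) • (word A x * eAB j * word B y) := by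
          rw [h4, Matrix.smul_mul, Matrix.mul_smul, ← Matrix.mul_assoc, h5, smul_smul, smul_smul,
            mul_assoc, mul_comm cAB]
  have h7 := smul_left_injective ℂ hne h6
  rw [eq_div_iff hLB0, h7, mul_comm]

/-- Words of the injective tensors span, so `B^u` and `A^y` may be replaced by matrix units, which
isolate one entry of each factor. -/
theorem apply_mul_apply_of_trace_words (hA : IsInjective A) (hB : IsInjective B) {m n : ℕ}
    {P p : Matrix β α ℂ} {Q q : Matrix α β ℂ} {c : ℂ}
    (h : ∀ u y : List ι, u.length = m + 1 → y.length = n + 1 →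
      (word B u * P * word A y * Q).trace = c * (word B u * p * word A y * q).trace)
    (b : β) (a : α) (a' : α) (b' : β) : P b a * Q a' b' = c * (p b a * q a' b') := by
  have h1 : ∀ (M : Matrix β β ℂ) (y : List ι), y.length = n + 1 →
      (M * P * word A y * Q).trace = c * (M * p * word A y * q).trace := by
    intro M y hy
    refine hB.forall_of_words (n := m) (p := fun M =>
      (M * P * word A y * Q).trace = c * (M * p * word A y * q).trace)
      (fun u hu => h u y hu hy) (by simp) (fun M N hM hN => ?_) (fun c M hM => ?_) M
    · simp only [Matrix.add_mul, Matrix.trace_add, hM, hN, mul_add]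
    · simp only [Matrix.smul_mul, Matrix.trace_smul, hM, smul_eq_mul]; ring
  have h2 : ∀ (M : Matrix β β ℂ) (N : Matrix α α ℂ),
      (M * P * N * Q).trace = c * (M * p * N * q).trace := by
    intro M N
    refine hA.forall_of_words (n := n) (p := fun N =>
      (M * P * N * Q).trace = c * (M * p * N * q).trace)
      (fun y hy => h1 M y hy) (by simp) (fun N N' hM hN => ?_) (fun c N hM => ?_) N
    · simp only [Matrix.mul_add, Matrix.add_mul, Matrix.trace_add, hM, hN, mul_add]
    · simp only [Matrix.mul_smul, Matrix.smul_mul, Matrix.trace_smul, hM, smul_eq_mul]; ring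
  have h3 : ∀ (P : Matrix β α ℂ) (Q : Matrix α β ℂ),
      (Matrix.single b' b (1 : ℂ) * P * Matrix.single a a' (1 : ℂ) * Q).trace = P b a * Q a' b' := by
    intro P Q
    rw [Matrix.mul_assoc, Matrix.mul_assoc, Matrix.trace_single_mul, ← Matrix.mul_assoc,
      Matrix.mul_apply, Finset.sum_eq_single a']
    · simp
    · intro k _ hk
      simp [Matrix.mul_apply, hk.symm]
    · simp
  rw [← h3, ← h3, h2]

/-- A nonzero product tensor determines its two factors up to reciprocal scalars. -/
theorem exists_factors {σ τ : Type*} {P p : σ → ℂ} {Q q : τ → ℂ} {c : ℂ}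
    (h : ∀ s t, P s * Q t = c * (p s * q t)) (hc : c ≠ 0) (hp : ∃ s, p s ≠ 0) (hq : ∃ t, q t ≠ 0) :
    ∃ c₁ c₂ : ℂ, (∀ s, P s = c₁ * p s) ∧ (∀ t, Q t = c₂ * q t) ∧ c₂ * c₁ = c := by
  obtain ⟨s₀, hs⟩ := hp
  obtain ⟨t₀, ht⟩ := hq
  have h0 : P s₀ * Q t₀ ≠ 0 := by rw [h]; exact mul_ne_zero hc (mul_ne_zero hs ht)
  have hP := left_ne_zero_of_mul h0
  have hQ := right_ne_zero_of_mul h0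
  refine ⟨c * q t₀ / Q t₀, c * p s₀ / P s₀, fun s => ?_, fun t => ?_, ?_⟩
  · rw [div_mul_eq_mul_div, eq_div_iff hQ, h]; ring
  · rw [div_mul_eq_mul_div, eq_div_iff hP, mul_comm, h]; ring
  · rw [div_mul_div_comm, div_eq_iff h0, h]; ring

end Walls

/-! ### Periodic chains: the MPO acting on states with and without walls -/

section Global

open scoped Kronecker

set_option linter.unusedSectionVars false

variable {ι χ α β : Type*} [Fintype ι] [DecidableEq ι]
variable [Fintype χ] [DecidableEq χ] [Fintype α] [DecidableEq α] [Fintype β] [DecidableEq β]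
variable {T : ι → ι → Matrix χ χ ℂ} {A : ι → Matrix α α ℂ} {B : ι → Matrix β β ℂ}

theorem sum_fin_cons {M : Type*} [AddCommMonoid M] (n : ℕ) (f : (Fin (n + 1) → ι) → M) :
    ∑ v, f v = ∑ i, ∑ v : Fin n → ι, f (Fin.cons i v) := by
  rw [← (Fin.consEquiv fun _ : Fin (n + 1) => ι).sum_comp, Fintype.sum_prod_type]
  rfl

theorem sum_fin_append {M : Type*} [AddCommMonoid M] (a b : ℕ) (f : (Fin (a + b) → ι) → M) :
    ∑ v, f v = ∑ v : Fin a → ι, ∑ u : Fin b → ι, f (Fin.append v u) := by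
  rw [← (Fin.appendEquiv a b).sum_comp, Fintype.sum_prod_type]
  rfl

theorem mpo_apply (T : ι → ι → Matrix χ χ ℂ) (N : ℕ) (s t : Fin N → ι) :
    mpo T N s t = (word (vec T) ((List.ofFn s).zip (List.ofFn t))).trace := by
  have h : (List.ofFn s).zip (List.ofFn t) = List.ofFn fun n => (s n, t n) := by
    apply List.ext_getElem <;> simp
  rw [h, word, List.map_ofFn]
  rfl

theorem wallState_eq {eAB : ι → Matrix α β ℂ} {eBA : ι → Matrix β α ℂ} {N : ℕ} (k l : Fin N)
    (s : Fin N → ι) {x y z : List ι} {i j : ι} (hs : List.ofFn s = x ++ i :: (y ++ j :: z))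
    (hk : (k : ℕ) = x.length) (hl : (l : ℕ) = x.length + 1 + y.length) :
    wallState A B eAB eBA N k l s =
      (word A x * eAB i * word B y * eBA j * word A z).trace := by
  have h1 : ∀ n : Fin N, some (s n) = (x ++ i :: (y ++ j :: z))[(n : ℕ)]? := by
    intro n
    rw [← hs]
    simp
  have hi : s k = i := by
    have := h1 k
    rw [hk] at this
    simpa using this
  have hj : s l = j := by
    have := h1 l
    rw [hl, List.getElem?_append_right (by omega)] at this
    simpa [show x.length + 1 + y.length - x.length = y.length + 1 by omega] using this
  have ht1 : (x ++ i :: (y ++ j :: z)).take x.length = x := by simp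
  have ht2 : ((x ++ i :: (y ++ j :: z)).take (x.length + 1 + y.length)).drop (x.length + 1) = y := by
    have h : x ++ i :: (y ++ j :: z) = (x ++ [i]) ++ (y ++ j :: z) := by simp
    rw [h, List.drop_take, List.drop_left' (by simp)]
    simp
  have ht3 : (x ++ i :: (y ++ j :: z)).drop (x.length + 1 + y.length + 1) = z := by
    have h : x ++ i :: (y ++ j :: z) = (x ++ [i] ++ y ++ [j]) ++ z := by simp
    rw [h, List.drop_left' (by simp; omega)]
  rw [wallState, hi, hj, hs, hk, hl, ht1, ht2, ht3]

theorem mpo_mulVec_mps (T : ι → ι → Matrix χ χ ℂ) (A : ι → Matrix α α ℂ) (N : ℕ) :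
    (mpo T N).mulVec (mps A N) = mps (act T A) N := by
  funext s
  rw [Matrix.mulVec, dotProduct, mps, word_act T A _ N List.length_ofFn, Matrix.trace_sum]
  refine Finset.sum_congr rfl fun t _ => ?_
  rw [mpo_apply, mps, Matrix.trace_kronecker]

/-- The action of the MPO on a state with two walls, site by site. -/
theorem mpo_mulVec_wallState (eAB : ι → Matrix α β ℂ) (eBA : ι → Matrix β α ℂ) {p q r : ℕ}
    (k l : Fin (p + (q + (r + 1) + 1))) (hk : (k : ℕ) = p) (hl : (l : ℕ) = p + 1 + q)
    (x : Fin p → ι) (i : ι) (y : Fin q → ι) (j : ι) (z : Fin r → ι) :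
    (mpo T _).mulVec (wallState A B eAB eBA _ k l)
        (Fin.append x (Fin.cons i (Fin.append y (Fin.cons j z)))) =
      (word (act T A) (List.ofFn x) * act T eAB i * word (act T B) (List.ofFn y) * act T eBA j *
        word (act T A) (List.ofFn z)).trace := by
  rw [word_act_mul_act_mul_word_act (hx := List.length_ofFn) (hy := List.length_ofFn),
    word_act (hw := List.length_ofFn), Matrix.mul_assoc, act]
  rw [Matrix.mulVec, dotProduct, sum_fin_append, Matrix.sum_mul, Matrix.trace_sum]
  refine Finset.sum_congr rfl fun x' _ => ?_
  rw [sum_fin_cons, Matrix.sum_mul, Matrix.trace_sum]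
  refine Finset.sum_congr rfl fun i' _ => ?_
  rw [sum_fin_append, Matrix.sum_mul, Matrix.trace_sum]
  refine Finset.sum_congr rfl fun y' _ => ?_
  rw [sum_fin_cons, Matrix.sum_mul, Matrix.mul_sum, Matrix.trace_sum]
  refine Finset.sum_congr rfl fun j' _ => ?_
  rw [Matrix.mul_sum, Matrix.mul_sum, Matrix.trace_sum]
  refine Finset.sum_congr rfl fun z' _ => ?_
  have hs : ∀ (x : Fin p → ι) (i : ι) (y : Fin q → ι) (j : ι) (z : Fin r → ι),
      List.ofFn (Fin.append x (Fin.cons i (Fin.append y (Fin.cons j z)))) =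
        List.ofFn x ++ i :: (List.ofFn y ++ j :: List.ofFn z) := by
    intro x i y j z
    simp only [List.ofFn_fin_append, List.ofFn_cons]
  rw [mpo_apply, wallState_eq k l _ (hs x' i' y' j' z') (by simpa using hk) (by simpa using hl), hs,
    hs, List.zip_append (by simp), List.zip_cons_cons, List.zip_append (by simp),
    List.zip_cons_cons, ← Matrix.mul_kronecker_mul, ← Matrix.mul_kronecker_mul,
    Matrix.trace_kronecker]
  congr 2
  · simp only [word_append, word_cons, Matrix.mul_assoc]
    rfl
  · simp only [Matrix.mul_assoc]

end Global

/-! ### From a global exchange of walls to local factors -/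

section Main

open scoped Kronecker

set_option linter.unusedSectionVars false

theorem word_flatten {κ ι α : Type*} [Fintype α] [DecidableEq α] (X : ι → Matrix α α ℂ)
    (φ : κ → List ι) (W : List κ) :
    word (fun s => word X (φ s)) W = word X (W.map φ).flatten := by
  induction W with
  | nil => rfl
  | cons s W ih => rw [word_cons, ih, List.map_cons, List.flatten_cons, word_append]

variable {ι χ χ' α β : Type*} [Fintype ι] [DecidableEq ι]
variable [Fintype χ] [DecidableEq χ] [Fintype χ'] [DecidableEq χ'] [Fintype α] [DecidableEq α]
  [Fintype β] [DecidableEq β]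
variable {T : ι → ι → Matrix χ χ ℂ} {A : ι → Matrix α α ℂ} {B : ι → Matrix β β ℂ}

theorem exists_ofFn_eq (w : List ι) {n : ℕ} (h : w.length = n) : ∃ s : Fin n → ι, List.ofFn s = w := by
  subst h
  exact ⟨w.get, List.ofFn_get w⟩

/-- In each region the two letters next to the walls are kept and the nonempty rest is replaced by
the reduced string. The cyclic trace then contains just one local block per wall. -/
theorem trace_cyclic_apply (WB : ActionTensors T A B) (WA : ActionTensors T B A)
    (eAB : ι → Matrix α β ℂ) (eBA : ι → Matrix β α ℂ) {u y : List ι} (hu : u ≠ []) (hy : y ≠ [])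
    (a b i a' b' j : ι) :
    (word (act T A) (a :: (u ++ [b])) * act T eAB i * word (act T B) (a' :: (y ++ [b'])) *
      act T eBA j).trace =
    (word B u * (WB.left * (act T A b * act T eAB i * act T B a') * WA.right) * word A y *
      (WA.left * (act T B b' * act T eBA j * act T A a) * WB.right)).trace := by
  have h1 := WB.replace a b u hu
  have h2 := WA.replace a' b' y hy
  simp only [word_cons, word_append, word_nil, Matrix.mul_one]
  calc _ = ((act T A a * word (act T A) u * act T A b) * act T eAB i *
        (act T B a' * word (act T B) y * act T B b') * act T eBA j).trace := by
        simp only [Matrix.mul_assoc]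
    _ = ((act T A a * WB.right) * (word B u * WB.left * act T A b * act T eAB i * act T B a' *
          WA.right * word A y * WA.left * act T B b' * act T eBA j)).trace := by
        rw [h1, h2]; simp only [Matrix.mul_assoc]
    _ = _ := by
        rw [Matrix.trace_mul_comm]; simp only [Matrix.mul_assoc]

/-- After cutting, the trace identity relates two products of wall blocks; since inner words span,
the blocks satisfy an equality of tensor products and are separately proportional. -/
theorem exists_wallFactors (hA : IsInjective A) (hB : IsInjective B)
    (hTsq : ∀ N : ℕ, 0 < N → mpo T N * mpo T N = 1) (WB : ActionTensors T A B)
    (WA : ActionTensors T B A) {eAB : ι → Matrix α β ℂ} {eBA : ι → Matrix β α ℂ} (hAB : eAB ≠ 0)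
    (hBA : eBA ≠ 0) {N : ℕ} {k l : Fin N} {c : ℂ} (hkl : (k : ℕ) + 4 ≤ l)
    (hlN : (l : ℕ) + 4 ≤ N + k)
    (hU : (mpo T N).mulVec (wallState A B eAB eBA N k l) = c • wallState B A eBA eAB N k l) :
    ∃ cAB cBA : ℂ, IsWallFactor T A B WB WA eAB eBA cAB ∧ IsWallFactor T B A WA WB eBA eAB cBA ∧
      cBA * cAB = c := by
  obtain ⟨p, hp⟩ : ∃ p, (k : ℕ) = p := ⟨_, rfl⟩
  obtain ⟨q, hq⟩ : ∃ q, (l : ℕ) = p + 1 + q := Nat.exists_eq_add_of_le (by omega)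
  obtain ⟨r, hr⟩ : ∃ r, N = l + 1 + r := Nat.exists_eq_add_of_le (by omega)
  obtain rfl : N = p + (q + (r + 1) + 1) := by omega
  have hs : ∀ (x : Fin p → ι) (i : ι) (y : Fin q → ι) (j : ι) (z : Fin r → ι),
      List.ofFn (Fin.append x (Fin.cons i (Fin.append y (Fin.cons j z)))) =
        List.ofFn x ++ i :: (List.ofFn y ++ j :: List.ofFn z) := by
    intro x i y j z
    simp only [List.ofFn_fin_append, List.ofFn_cons]
  -- By cyclicity of the trace, the sites after the second wall and before the first form a single
  -- word of length `r + p`.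
  have hE : ∀ (u y : List ι) (i j : ι), u.length = r + p → y.length = q →
      (word (act T A) u * act T eAB i * word (act T B) y * act T eBA j).trace =
        c * (word B u * eBA i * word A y * eAB j).trace := by
    intro u y i j hu hy
    obtain ⟨z, v, x, rfl, hz, hx, hv⟩ := exists_split u r p hu.ge
    obtain rfl : v = [] := List.length_eq_zero_iff.1 (by omega)
    obtain ⟨x, rfl⟩ := exists_ofFn_eq x hx
    obtain ⟨y, rfl⟩ := exists_ofFn_eq y hy
    obtain ⟨z, rfl⟩ := exists_ofFn_eq z hz
    have h := congrFun hU (Fin.append x (Fin.cons i (Fin.append y (Fin.cons j z))))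
    rw [mpo_mulVec_wallState eAB eBA k l hp hq, Pi.smul_apply, smul_eq_mul,
      wallState_eq k l _ (hs x i y j z) (by simpa using hp) (by simpa using hq),
      Matrix.trace_mul_comm, Matrix.trace_mul_comm _ (word B (List.ofFn z))] at h
    simpa only [List.nil_append, word_append, Matrix.mul_assoc] using h
  obtain ⟨i₀, hi₀⟩ : ∃ i, eAB i ≠ 0 := by
    by_contra! hcon
    exact hAB (funext hcon)
  obtain ⟨j₀, hj₀⟩ : ∃ j, eBA j ≠ 0 := by
    by_contra! hcon
    exact hBA (funext hcon)
  -- As `U ^ 2 = 1`, the factor `c = 0` would annihilate the two-wall state itself, and injectivity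
  -- would then force one of the wall tensors at `i₀`, `j₀` to vanish.
  have hc : c ≠ 0 := by
    rintro rfl
    have h0 : wallState A B eAB eBA (p + (q + (r + 1) + 1)) k l = 0 := by
      rw [← Matrix.one_mulVec (wallState A B eAB eBA _ k l), ← hTsq _ (by omega),
        ← Matrix.mulVec_mulVec, hU, zero_smul, Matrix.mulVec_zero]
    have h1 : ∀ (a : α) (b b' : β) (a' : α), eAB i₀ a b * eBA j₀ b' a' = 0 := by
      intro a b b' a'
      have := apply_mul_apply_of_trace_words hB hA (m := r + p - 1) (n := q - 1) (P := eAB i₀)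
        (Q := eBA j₀) (p := 0) (q := 0) (c := 0) (fun u y hu hy => ?_) a b b' a'
      · simpa using this
      · obtain ⟨z, v, x, rfl, hz, hx, hv⟩ := exists_split u r p (by omega)
        obtain rfl : v = [] := List.length_eq_zero_iff.1 (by omega)
        obtain ⟨x, rfl⟩ := exists_ofFn_eq x hx
        obtain ⟨y, rfl⟩ := exists_ofFn_eq y (show y.length = q by omega)
        obtain ⟨z, rfl⟩ := exists_ofFn_eq z hz
        have h := congrFun h0 (Fin.append x (Fin.cons i₀ (Fin.append y (Fin.cons j₀ z))))
        rw [wallState_eq k l _ (hs x i₀ y j₀ z) (by simpa using hp) (by simpa using hq),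
          Pi.zero_apply, Matrix.trace_mul_comm] at h
        simpa only [List.nil_append, word_append, Matrix.mul_assoc, zero_mul] using h
    refine hi₀ (Matrix.ext fun a b => by_contra fun hne => hj₀ (Matrix.ext fun b' a' => ?_))
    exact (mul_eq_zero.1 (h1 a b b' a')).resolve_left hne
  have hPQ : ∀ (s : (ι × ι × ι) × β × α) (t : (ι × ι × ι) × α × β),
      (WB.left * (act T A s.1.1 * act T eAB s.1.2.1 * act T B s.1.2.2) * WA.right) s.2.1 s.2.2 *
        (WA.left * (act T B t.1.1 * act T eBA t.1.2.1 * act T A t.1.2.2) * WB.right) t.2.1 t.2.2 =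
      c * ((B s.1.1 * eBA s.1.2.1 * A s.1.2.2) s.2.1 s.2.2 *
        (A t.1.1 * eAB t.1.2.1 * B t.1.2.2) t.2.1 t.2.2) := by
    rintro ⟨⟨b, i, a'⟩, s₁, s₂⟩ ⟨⟨b', j, a⟩, t₁, t₂⟩
    -- Two letters of each region go to the wall blocks, leaving `r + p - 2` and `q - 2` inner
    -- letters; these are positive exactly because each region has at least three sites.
    refine apply_mul_apply_of_trace_words hA hB (m := r + p - 3) (n := q - 3)
      (fun u y hu hy => ?_) s₁ s₂ t₁ t₂
    rw [← trace_cyclic_apply WB WA eAB eBA (by rintro rfl; simp at hu) (by rintro rfl; simp at hy),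
      hE _ _ _ _ (by simp; omega) (by simp; omega)]
    simp only [word_cons, word_append, word_nil, Matrix.mul_one]
    congr 1
    rw [Matrix.mul_assoc (B a), Matrix.mul_assoc (B a), Matrix.mul_assoc (B a),
      Matrix.trace_mul_comm]
    simp only [Matrix.mul_assoc]
  obtain ⟨c₁, c₂, h1, h2, h3⟩ := exists_factors hPQ hc
    (by
      obtain ⟨x, y, hx, hy, hne⟩ := exists_word_mul_word_ne_zero hB hA 0 0 hj₀
      obtain ⟨b, rfl⟩ := List.length_eq_one_iff.1 hx
      obtain ⟨a, rfl⟩ := List.length_eq_one_iff.1 hy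
      rw [word_singleton, word_singleton] at hne
      by_contra! hcon
      exact hne (Matrix.ext fun s t => hcon ((b, j₀, a), s, t)))
    (by
      obtain ⟨x, y, hx, hy, hne⟩ := exists_word_mul_word_ne_zero hA hB 0 0 hi₀
      obtain ⟨b, rfl⟩ := List.length_eq_one_iff.1 hx
      obtain ⟨a, rfl⟩ := List.length_eq_one_iff.1 hy
      rw [word_singleton, word_singleton] at hne
      by_contra! hcon
      exact hne (Matrix.ext fun s t => hcon ((b, i₀, a), s, t)))
  exact ⟨c₁, c₂, fun i j k => Matrix.ext fun s t => h1 ((i, j, k), s, t),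
    fun i j k => Matrix.ext fun s t => h2 ((i, j, k), s, t), h3⟩

/-! ### Existence of fusion and action tensors after blocking -/

section Blocking

/-- Long reductions become reductions after blocking. -/
theorem nonempty_reduction_of_long {κ ι : Type*} {X : ι → Matrix β β ℂ} {Y : ι → Matrix α α ℂ}
    {L : Matrix α β ℂ} {R : Matrix β α ℂ} {K : ℕ} (hred : ∀ w, L * word X w * R = word Y w)
    (hrep : ∀ u w v : List ι, K ≤ u.length → w ≠ [] → K ≤ v.length →
        word X u * word X w * word X v = word X u * (R * word Y w * L) * word X v)
    (φ : κ → List ι) (hφ : ∀ s, K ≤ (φ s).length) (hφ0 : ∀ s, φ s ≠ []) :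
    Nonempty (Reduction (fun s => word X (φ s)) (fun s => word Y (φ s))) :=
  ⟨{ left := L
     right := R
     reduce := fun w => by rw [word_flatten, word_flatten, hred]
     replace := fun i j w hw => by
      rw [word_flatten, word_flatten]
      refine hrep _ _ _ (hφ i) ?_ (hφ j)
      obtain ⟨s, w, rfl⟩ := List.exists_cons_of_ne_nil hw
      simp [hφ0] }⟩

theorem blockMPO_apply (k : ℕ) (T : ι → ι → Matrix χ χ ℂ) (s t : Fin k → ι) :
    blockMPO k T s t = word (vec T) ((List.ofFn s).zip (List.ofFn t)) := by
  have h : (List.ofFn s).zip (List.ofFn t) = List.ofFn fun n => (s n, t n) := by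
    apply List.ext_getElem <;> simp
  rw [h, word, List.map_ofFn]
  rfl

theorem act_block (k : ℕ) (T : ι → ι → Matrix χ χ ℂ) (X : ι → Matrix α α ℂ) :
    act (blockMPO k T) (blockMPS k X) = fun s => word (act T X) (List.ofFn s) := by
  funext s
  rw [word_act T X _ k List.length_ofFn, act]
  simp only [blockMPO_apply, blockMPS]

theorem word_stack (T : ι → ι → Matrix χ χ ℂ) (S : ι → ι → Matrix χ' χ' ℂ) (w z : List ι) (n : ℕ)
    (hw : w.length = n) (hz : z.length = n) :
    word (vec (stack T S)) (w.zip z) = ∑ v : Fin n → ι,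
      word (vec T) (w.zip (List.ofFn v)) ⊗ₖ word (vec S) ((List.ofFn v).zip z) := by
  induction w generalizing n z with
  | nil => subst hw; simp [word]
  | cons i w ih =>
    obtain rfl : n = w.length + 1 := hw.symm
    obtain ⟨j, z, rfl⟩ := List.exists_cons_of_length_eq_add_one hz
    rw [List.zip_cons_cons, word_cons, ih z _ rfl (by simpa using hz),
      sum_ofFn_succ w.length fun v => word (vec T) ((i :: w).zip v) ⊗ₖ word (vec S) (v.zip (j :: z))]
    simp only [List.zip_cons_cons, word_cons, Matrix.mul_kronecker_mul, vec, stack, act,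
      Finset.sum_mul_sum]

theorem word_idTensor (w z : List ι) (h : w.length = z.length) :
    word idTensor (w.zip z) = if w = z then 1 else 0 := by
  induction w generalizing z with
  | nil =>
    obtain rfl := List.length_eq_zero_iff.1 h.symm
    simp [word]
  | cons i w ih =>
    obtain ⟨j, z, rfl⟩ := List.exists_cons_of_length_eq_add_one h.symm
    rw [List.zip_cons_cons, word_cons, ih z (by simpa using h), idTensor]
    by_cases hij : i = j <;> by_cases hwz : w = z <;> simp [hij, hwz]

theorem exists_zip_ofFn (w : List (ι × ι)) :
    ∃ s t : Fin w.length → ι, w = (List.ofFn s).zip (List.ofFn t) := by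
  refine ⟨fun n => (w.get n).1, fun n => (w.get n).2, ?_⟩
  apply List.ext_getElem <;> simp

/-- The equation for the states says that the words of `TA` and `B` have equal traces, which gives a
reduction valid up to margins of length `K`; a block of at least `K` sites is such a margin. -/
theorem exists_blocked_action [Nonempty β]
    (hB : IsInjective B) (hAB : ∀ N : ℕ, 0 < N → (mpo T N).mulVec (mps A N) = mps B N) :
    ∃ K : ℕ, ∀ k : ℕ, K ≤ k → 0 < k →
      Nonempty (ActionTensors (blockMPO k T) (blockMPS k A) (blockMPS k B)) := by
  obtain ⟨L, R, K, hred, hrep⟩ := exists_reduction_of_trace_eq (X := act T A) hB fun w hw => by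
    have h := congrFun (hAB w.length (List.length_pos_iff.2 hw)) w.get
    rw [mpo_mulVec_mps, mps, mps, List.ofFn_get] at h
    exact h
  refine ⟨K, fun k hk hk0 => ?_⟩
  rw [ActionTensors, act_block]
  exact nonempty_reduction_of_long hred hrep List.ofFn (by simpa using fun _ => hk)
    (fun s h => by simpa [hk0.ne'] using congrArg List.length h)

/-- The entries of `U ^ 2 = 1` are equalities of traces between words of `TT` and of the identity
tensor, which is injective with bond dimension one. -/
theorem exists_blocked_fusion [Nonempty ι] (hTsq : ∀ N : ℕ, 0 < N → mpo T N * mpo T N = 1) :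
    ∃ K : ℕ, ∀ k : ℕ, K ≤ k → 0 < k → Nonempty (FusionTensors (blockMPO k T)) := by
  obtain ⟨L, R, K, hred, hrep⟩ := exists_reduction_of_trace_eq (X := vec (stack T T))
    (isInjective_idTensor (ι := ι)) fun w hw => by
      obtain ⟨s, t, hst⟩ := exists_zip_ofFn w
      have h := congrFun (congrFun (hTsq w.length (List.length_pos_iff.2 hw)) s) t
      rw [hst, word_idTensor _ _ (by simp),
        word_stack T T _ _ w.length List.length_ofFn List.length_ofFn, Matrix.trace_sum]
      simp only [Matrix.trace_kronecker, ← mpo_apply]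
      rw [Matrix.mul_apply] at h
      rw [h, Matrix.one_apply]
      by_cases hs : s = t <;> simp [hs]
  refine ⟨K, fun k hk hk0 => ?_⟩
  have hX : vec (stack (blockMPO k T) (blockMPO k T)) =
      fun p => word (vec (stack T T)) ((List.ofFn p.1).zip (List.ofFn p.2)) := by
    funext p
    rw [word_stack T T _ _ k List.length_ofFn List.length_ofFn, vec, stack, act]
    simp only [blockMPO_apply]
  have hY : idTensor (ι := Fin k → ι) =
      fun p => word idTensor ((List.ofFn p.1).zip (List.ofFn p.2)) := by
    funext p
    rw [word_idTensor _ _ (by simp), idTensor]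
    simp
  rw [FusionTensors, hX, hY]
  exact nonempty_reduction_of_long hred hrep _ (by simpa using hk)
    (fun s h => by simpa [hk0.ne'] using congrArg List.length h)

end Blocking

end Main

/-! ### Uniqueness of the phase and assembly of the theorem -/

theorem IsPhase.isAnomalyPhase_iff {ι χ : Type*} [Fintype ι] [DecidableEq ι] [Fintype χ]
    [DecidableEq χ] [Nonempty χ] {T : ι → ι → Matrix χ χ ℂ} (hT : IsInjective (vec T))
    {F : FusionTensors T} {ω : ℂ} (h : IsPhase T F ω) (x : ℂ) : IsAnomalyPhase T F x ↔ x = ω := by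
  constructor
  · intro hx
    obtain ⟨w, hw, hw0⟩ := hT.exists_word_ne_zero 2
    have hne : w ≠ [] := by rintro rfl; simp at hw
    exact smul_left_injective ℂ hw0 ((hx w hw).symm.trans (h w hne))
  · rintro rfl w hw
    exact h w (by rintro rfl; simp at hw)

end MPU

theorem mainTheorem1 {ι χ α β : Type*}
    [Fintype ι] [DecidableEq ι] [Nonempty ι] [Fintype χ] [DecidableEq χ] [Nonempty χ]
    [Fintype α] [DecidableEq α] [Nonempty α] [Fintype β] [DecidableEq β] [Nonempty β]
    (T : ι → ι → Matrix χ χ ℂ) (A : ι → Matrix α α ℂ) (B : ι → Matrix β β ℂ)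
    (hT : MPU.IsMPU T) (hTinj : MPU.IsInjective (MPU.vec T))
    (hTsq : ∀ N : ℕ, 0 < N → MPU.mpo T N * MPU.mpo T N = 1)
    (hA : MPU.IsInjective A) (hB : MPU.IsInjective B)
    (hAB : ∀ N : ℕ, 0 < N → (MPU.mpo T N).mulVec (MPU.mps A N) = MPU.mps B N) :
    -- after blocking sufficiently many sites, fusion and action tensors exist
    (∃ k₀ : ℕ, 0 < k₀ ∧ ∀ k : ℕ, k₀ ≤ k →
      Nonempty (MPU.FusionTensors (MPU.blockMPO k T)) ∧
      Nonempty (MPU.ActionTensors (MPU.blockMPO k T) (MPU.blockMPS k A) (MPU.blockMPS k B)) ∧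
      Nonempty (MPU.ActionTensors (MPU.blockMPO k T) (MPU.blockMPS k B) (MPU.blockMPS k A))) ∧
    -- the anomaly phase is a sign, the same for every choice of fusion tensors
    ∃ ω : ℂ, (ω = 1 ∨ ω = -1) ∧
      ∀ F : MPU.FusionTensors T,
        (∀ x : ℂ, MPU.IsAnomalyPhase T F x ↔ x = ω) ∧
        ∀ (WB : MPU.ActionTensors T A B) (WA : MPU.ActionTensors T B A),
          ∃ LA LB : ℂ,
            (∀ x : ℂ, MPU.IsLSymbol T A B F WB WA x ↔ x = LA) ∧
            (∀ x : ℂ, MPU.IsLSymbol T B A F WA WB x ↔ x = LB) ∧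
            LA ≠ 0 ∧ LB ≠ 0 ∧ LA / LB = ω ∧
            ∀ (eAB : ι → Matrix α β ℂ) (eBA : ι → Matrix β α ℂ), eAB ≠ 0 → eBA ≠ 0 →
              (∀ cAB cBA : ℂ, MPU.IsWallFactor T A B WB WA eAB eBA cAB →
                MPU.IsWallFactor T B A WA WB eBA eAB cBA →
                cBA * cAB = LA / LB ∧ cBA * cAB = ω) ∧
              -- a global exchange of the two-wall states yields the local factors
              (∀ (N : ℕ) (k l : Fin N) (c : ℂ),
                (k : ℕ) + 4 ≤ (l : ℕ) → (l : ℕ) + 4 ≤ N + (k : ℕ) →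
                (MPU.mpo T N).mulVec (MPU.wallState A B eAB eBA N k l) =
                  c • MPU.wallState B A eBA eAB N k l →
                ∃ cAB cBA : ℂ, MPU.IsWallFactor T A B WB WA eAB eBA cAB ∧
                  MPU.IsWallFactor T B A WA WB eBA eAB cBA ∧
                  cBA * cAB = c ∧ c = LA / LB ∧ c = ω) := by
  have hBA : ∀ N : ℕ, 0 < N → (MPU.mpo T N).mulVec (MPU.mps B N) = MPU.mps A N := by
    intro N hN
    rw [← hAB N hN, Matrix.mulVec_mulVec, hTsq N hN, Matrix.one_mulVec]
  refine ⟨?_, ?_⟩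
  · obtain ⟨K₁, h₁⟩ := MPU.exists_blocked_fusion hTsq
    obtain ⟨K₂, h₂⟩ := MPU.exists_blocked_action hB hAB
    obtain ⟨K₃, h₃⟩ := MPU.exists_blocked_action hA hBA
    exact ⟨K₁ + K₂ + K₃ + 1, by omega, fun k hk =>
      ⟨h₁ k (by omega) (by omega), h₂ k (by omega) (by omega), h₃ k (by omega) (by omega)⟩⟩
  obtain ⟨ω, hsign, hω⟩ : ∃ ω : ℂ, (ω = 1 ∨ ω = -1) ∧
      ∀ F : MPU.FusionTensors T, MPU.IsPhase T F ω := by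
    by_cases hF : Nonempty (MPU.FusionTensors T)
    · obtain ⟨F₀⟩ := hF
      obtain ⟨ω, -, hω⟩ := MPU.exists_isPhase hTinj F₀
      refine ⟨ω, mul_self_eq_one_iff.1 (hω.mul_self hTinj), fun F => ?_⟩
      obtain ⟨ω', -, hω'⟩ := MPU.exists_isPhase hTinj F
      rwa [hω.eq_of_fusion hTinj hω']
    -- Without fusion tensors every condition on `ω` is vacuous, and `1` is an arbitrary choice.
    · exact ⟨1, Or.inl rfl, fun F => (hF ⟨F⟩).elim⟩
  refine ⟨ω, hsign, fun F => ⟨(hω F).isAnomalyPhase_iff hTinj, fun WB WA => ?_⟩⟩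
  obtain ⟨LA, hLA0, hLA, hLA'⟩ := MPU.exists_lsymbol hA F WB WA
  obtain ⟨LB, hLB0, hLB, -⟩ := MPU.exists_lsymbol hB F WA WB
  have hdiv : LA / LB = ω :=
    (div_eq_iff hLB0).2 (MPU.lsymbol_eq_phase_mul hB (hω F) WB WA hLA hLB)
  refine ⟨LA, LB, MPU.lsymbol_unique hA F WB WA hLA, MPU.lsymbol_unique hB F WA WB hLB, hLA0, hLB0,
    hdiv, fun eAB eBA heAB heBA => ?_⟩
  have hwall : ∀ cAB cBA : ℂ, MPU.IsWallFactor T A B WB WA eAB eBA cAB →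
      MPU.IsWallFactor T B A WA WB eBA eAB cBA → cBA * cAB = LA / LB := fun _ _ h₁ h₂ =>
    MPU.wallFactor_mul_wallFactor hA hB F WB WA hLB0 hLA' hLB heAB h₁ h₂
  refine ⟨fun cAB cBA h₁ h₂ => ⟨hwall _ _ h₁ h₂, (hwall _ _ h₁ h₂).trans hdiv⟩, ?_⟩
  intro N k l c hkl hlN hU
  obtain ⟨cAB, cBA, h₁, h₂, hc⟩ := MPU.exists_wallFactors hA hB hTsq WB WA heAB heBA hkl hlN hU
  have hcL : c = LA / LB := hc.symm.trans (hwall _ _ h₁ h₂)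
  exact ⟨cAB, cBA, h₁, h₂, hc, hcL, hcL.trans hdiv⟩
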